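/- **Definitions.** Graphs are finite and may have loops and multiple edges. A signed graph $(G,\Sigma)$ is a graph $G$ with a set $\Sigma\subseteq E(G)$ of negative edges. A circuit is negative if it contains an odd number of negative edges, and $(G,\Sigma)$ is balanced if it has no negative circuit. The frustration index $l(G,\Sigma)$ is the minimum cardinality of a set $F\subseteq E(G)$ such that $(G-F,\Sigma-F)$ is balanced. For $k\ge 1$, $(G,\Sigma)$ is $k$-critical if $l(G,\Sigma)=k$ and $l(G-e,\Sigma-\{e\})<k$ for every $e\in E(G)$. Subgraphs of a signed graph carry the inherited signs. A $k$-critical signed graph is decomposable if for some $n\ge 2$ and some $k_1,\dots,k_n\geq 1$ with $k_1+\dots+k_n=k$ it contains pairwise edge-disjoint subgraphs $H_1,\dots,H_n$ such that $H_i$ is $k_i$-critical. Let $S^*(k)$ be the set of $k$-critical signed graphs such that, for every $m\in\{1,\dots,k\}$, every $m$-critical subgraph is non-decomposable. **Walls.** A row of length $\ell$ consists of two disjoint paths $v_1\dots v_{2\ell+1}$ (upper) and $w_1\dots w_{2\ell+1}$ (lower) and the $\ell+1$ vertical edges $v_{2j+1}w_{2j+1}$, $0\le j\le \ell$. Let $k\ge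 3$, $t=\lfloor k/2\rfloor$ and $T=\lceil k/2\rceil$. Take a middle row $R^T$ of length $k-1$. For $i=T-1,\dots,1$ put a row $R^i$ of length $t+i-1$ on top of $R^{i+1}$ and a row $\check R^i$ of length $t+i-1$ below $\check R^{i+1}$ (where $\check R^T=R^T$): the lower path of $R^i$ is identified with the subpath of the upper path of $R^{i+1}$ obtained by deleting its first and its last vertex (first vertex of the new row onto the second vertex of the old one), and symmetrically at the bottom. Let $a_i=2i$ if $k$ is even and $a_i=2i-1$ if $k$ is odd. From each row $R^i$, $\check R^i$ with more than $2a_i$ vertical edges remove all vertical edges except the first $a_i$ and the last $a_i$. The result has $2T$ horizontal paths (each being the longest one at its height). Let $x_i$ be the first vertex of the $i$-th path from the top and $y_i$ the last vertex of the $i$-th path from the bottom, $1\le i\le 2T$. Add the edges $x_iy_i$ for $1\le i\le k$, and, if $k$ is odd, suppress the two divalent vertices $x_{k+1},y_{k+1}$. The resulting graph is $E_k$, and $\Sigma_k=\{x_iy_i : 1\le i\le k\}$. Let $(E_k^{\mathrm c},\Sigma_k^{\mathrm c})$ be the signed graph obtained from $(E_k,\Sigma_k)$ by suppressing all remaining divalent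 vertices (a new edge gets the product of the signs of the edges of the path that it replaces). **Theorem.** For each integer $k\ge 3$, $(E_k,\Sigma_k)\in S^*(k)$. Moreover, $E_k^{\mathrm c}$ is cubic and $(E_k^{\mathrm c},\Sigma_k^{\mathrm c})\in S^*(k)$. -/

import Mathlib

open Set

universe u v

/-- A signed graph `(G, Σ)`: a graph (loops and multiple edges are allowed) together with a set
of negative edges. -/
structure SignedGraph (α : Type u) (β : Type v) where
  /-- the underlying graph -/
  graph : Graph α β
  /-- the set of negative edges -/
  neg : Set β
  neg_subset : neg ⊆ graph.edgeSet

namespace Graph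

variable {α : Type u} {β : Type v}

/-- `C` is the edge set of a circuit of `G`: there are distinct vertices `v 0, …, v (n - 1)` and
distinct edges `e 0, …, e (n - 1)` such that `e i` joins `v i` and `v (i + 1)`, where `v n = v 0`.
A loop is a circuit of length one, two parallel edges form a circuit of length two. -/
def IsCircuit (G : Graph α β) (C : Set β) : Prop :=
  ∃ (n : ℕ) (v : ℕ → α) (e : ℕ → β), 0 < n ∧ InjOn v (Iio n) ∧ InjOn e (Iio n) ∧
    v n = v 0 ∧ (∀ i < n, G.IsLink (e i) (v i) (v (i + 1))) ∧ C = e '' Iio n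

/-- The degree of a vertex; a loop counts twice. -/
noncomputable def degree (G : Graph α β) (x : α) : ℕ∞ :=
  (G.incidenceSet x).encard + (G.loopSet x).encard

/-- All vertices have degree three. -/
def IsCubic (G : Graph α β) : Prop := ∀ x ∈ G.vertexSet, G.degree x = 3

/-- `F` is the edge set of a path of positive length between the vertices `x` and `y` outside `D`
(`x = y` is allowed) all of whose inner vertices are in `D`. -/
def IsThread (G : Graph α β) (D : Set α) (F : Set β) (x y : α) : Prop :=
  x ∉ D ∧ y ∉ D ∧
  ∃ (n : ℕ) (v : ℕ → α) (e : ℕ → β), 0 < n ∧ v 0 = x ∧ v n = y ∧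
    (∀ i ∈ Ioo 0 n, v i ∈ D) ∧ InjOn v (Ioo 0 n) ∧ InjOn e (Iio n) ∧
    (∀ i < n, G.IsLink (e i) (v i) (v (i + 1))) ∧ F = e '' Iio n

theorem IsThread.symm {G : Graph α β} {D : Set α} {F : Set β} {x y : α}
    (h : G.IsThread D F x y) : G.IsThread D F y x := by
  obtain ⟨hx, hy, n, v, e, hn, h0, hn', hD, hv, he, hl, rfl⟩ := h
  refine ⟨hy, hx, n, fun i => v (n - i), fun i => e (n - 1 - i), hn, by simpa using hn',
    by simpa using h0, ?_, ?_, ?_, ?_, ?_⟩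
  · rintro i ⟨h1, h2⟩
    exact hD _ ⟨by omega, by omega⟩
  · rintro i ⟨h1, h2⟩ j ⟨h3, h4⟩ hij
    have : n - i = n - j := hv ⟨by omega, by omega⟩ ⟨by omega, by omega⟩ hij
    omega
  · intro i hi j hj hij
    simp only [mem_Iio] at hi hj
    have : n - 1 - i = n - 1 - j := he (show _ < n by omega) (show _ < n by omega) hij
    omega
  · intro i hi
    have h := (hl (n - 1 - i) (by omega)).symm
    rw [show n - 1 - i + 1 = n - i by omega] at h
    show G.IsLink (e (n - 1 - i)) (v (n - i)) (v (n - (i + 1)))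
    rwa [show n - (i + 1) = n - 1 - i by omega]
  · ext b
    constructor
    · rintro ⟨i, hi, rfl⟩
      simp only [mem_Iio] at hi
      exact ⟨n - 1 - i, show _ < n by omega, by
        show e (n - 1 - (n - 1 - i)) = e i
        congr 1; omega⟩
    · rintro ⟨i, hi, rfl⟩
      exact ⟨n - 1 - i, show _ < n by omega, rfl⟩

theorem IsThread.left_eq_or_eq {G : Graph α β} {D : Set α} {F : Set β} {x y x' y' : α}
    (h : G.IsThread D F x y) (h' : G.IsThread D F x' y') : x = x' ∨ x = y' := by
  obtain ⟨hx, -, n, v, e, hn, h0, -, -, -, -, hl, rfl⟩ := h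
  obtain ⟨-, -, m, w, f, hm, h0', hm', hD', -, -, hl', hF⟩ := h'
  have key : ∀ j ≤ m, w j = x → x = x' ∨ x = y' := by
    intro j hj hw
    rcases Nat.eq_zero_or_pos j with rfl | hj0
    · exact Or.inl (hw.symm.trans h0')
    · rcases hj.eq_or_lt with rfl | hjm
      · exact Or.inr (hw.symm.trans hm')
      · exact absurd (hw ▸ hD' j ⟨hj0, hjm⟩) hx
  have h1 : e 0 ∈ f '' Iio m := hF ▸ ⟨0, hn, rfl⟩
  obtain ⟨j, hj, hje⟩ := h1
  have h2 := hl 0 hn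
  rw [← hje, h0] at h2
  rcases h2.left_eq_or_eq (hl' j hj) with h | h
  · exact key j (le_of_lt hj) h.symm
  · exact key (j + 1) hj h.symm

/-- The graph obtained from `G` by suppressing the vertices in `D`, which is meant to be a set of
divalent vertices: these vertices are removed, and each path with inner vertices in `D` and ends
outside `D` becomes one edge. This edge is named by the set of edges of the path, so an edge `e` of
`G` between vertices outside `D` becomes the edge `{e}`. -/
def suppress (G : Graph α β) (D : Set α) : Graph α (Set β) where
  vertexSet := G.vertexSet \ D
  IsLink := G.IsThread D
  isLink_symm _ _ := ⟨fun _ _ h => h.symm⟩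
  eq_or_eq_of_isLink_of_isLink _ _ _ _ _ h h' := h.left_eq_or_eq h'
  left_mem_of_isLink F x y h := by
    obtain ⟨hx, -, n, v, e, hn, rfl, -, -, -, -, hl, -⟩ := h
    exact ⟨(hl 0 hn).left_mem, hx⟩

end Graph

namespace SignedGraph

variable {α : Type u} {β : Type v}

/-- A set of edges is negative if it has an odd number of negative edges. -/
def IsNegative (G : SignedGraph α β) (C : Set β) : Prop := Odd (C ∩ G.neg).ncard

/-- There is no negative circuit. -/
def Balanced (G : SignedGraph α β) : Prop :=
  ∀ C, G.graph.IsCircuit C → ¬ G.IsNegative C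

/-- The signed graph `(G - F, Σ - F)`. -/
def deleteEdges (G : SignedGraph α β) (F : Set β) : SignedGraph α β where
  graph := G.graph.deleteEdges F
  neg := G.neg \ F
  neg_subset := by
    intro e he
    simpa using And.intro (G.neg_subset he.1) he.2

/-- The frustration index: the minimum cardinality of a set `F` of edges such that
`(G - F, Σ - F)` is balanced. -/
noncomputable def frustrationIndex (G : SignedGraph α β) : ℕ∞ :=
  sInf (encard '' {F : Set β | F ⊆ G.graph.edgeSet ∧ (G.deleteEdges F).Balanced})

/-- `k`-critical signed graphs, for `k ≥ 1`. -/
def IsCritical (G : SignedGraph α β) (k : ℕ) : Prop :=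
  1 ≤ k ∧ G.frustrationIndex = k ∧
    ∀ e ∈ G.graph.edgeSet, (G.deleteEdges {e}).frustrationIndex < k

/-- `H` is a subgraph of `G`, with the signs inherited from `G`. -/
def IsSubgraph (H G : SignedGraph α β) : Prop :=
  H.graph ≤ G.graph ∧ H.neg = G.neg ∩ H.graph.edgeSet

/-- `G` is a critical signed graph that is `(c 0, …, c (n - 1))`-decomposable for some `n ≥ 2`:
it is `(c 0 + ⋯ + c (n - 1))`-critical and contains pairwise edge-disjoint `c i`-critical
subgraphs `H i`. -/
def IsDecomposable (G : SignedGraph α β) : Prop :=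
  ∃ (n : ℕ) (c : Fin n → ℕ) (H : Fin n → SignedGraph α β), 2 ≤ n ∧
    G.IsCritical (∑ i, c i) ∧
    (∀ i, (H i).IsSubgraph G ∧ (H i).IsCritical (c i)) ∧
    Pairwise fun i j => Disjoint (H i).graph.edgeSet (H j).graph.edgeSet

/-- The class `S*(k)` of `k`-critical signed graphs all of whose `m`-critical subgraphs are
non-decomposable, for every `m ∈ {1, …, k}`. -/
def SStar (k : ℕ) : Set (SignedGraph α β) :=
  {G | G.IsCritical k ∧ ∀ m ∈ Icc 1 k, ∀ H : SignedGraph α β,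
    H.IsSubgraph G → H.IsCritical m → ¬ H.IsDecomposable}

/-- Suppression of a set `D` of divalent vertices; the sign of a new edge is the product of the
signs of the edges of the path that it replaces. -/
def suppress (G : SignedGraph α β) (D : Set α) : SignedGraph α (Set β) where
  graph := G.graph.suppress D
  neg := {F | F ∈ (G.graph.suppress D).edgeSet ∧ G.IsNegative F}
  neg_subset _ h := h.1

end SignedGraph

/-! ### The walls

All walls are drawn in the grid `ℕ × ℕ`: the vertex `(p, c)` is in the `p`-th horizontal path,
counted from the top and starting with `1`, and in column `c`. The wall of size `k` has
`2T` horizontal paths, `T = ⌈k / 2⌉`, and `2T - 1` rows; the `r`-th row from the top lies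
between paths `r` and `r + 1`, and it is `R^i` with `i = r` if `r ≤ T`, and `Ř^i` with
`i = 2T - r` if `r ≥ T`. Sticking a row to the next longer one, with the first vertex of its path
identified with the second vertex of the longer path, means that rows `R^i` and `Ř^i` start in
column `T - i`. -/

namespace Wall

/-- `T = ⌈k / 2⌉`, the index of the middle (longest) row. -/
def mid (k : ℕ) : ℕ := (k + 1) / 2

/-- The number of horizontal paths: `k` if `k` is even, `k + 1` if `k` is odd. -/
def numPaths (k : ℕ) : ℕ := 2 * mid k

/-- The index `i` for which the `r`-th row from the top is `R^i` or `Ř^i`. -/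
def rowIndex (k r : ℕ) : ℕ := min r (2 * mid k - r)

/-- The length (number of bricks before the removal of vertical edges) of rows `R^i` and `Ř^i`:
with `t = ⌊k / 2⌋` it is `t + i - 1`, so the middle row has length `k - 1`, and the length
decreases by one from each row to the next one further out. -/
def rowLength (k i : ℕ) : ℕ := k / 2 + i - 1

/-- The number of vertical edges kept at each end of rows `R^i` and `Ř^i`: `2i` for even `k`
and `2i - 1` for odd `k`. -/
def keep (k i : ℕ) : ℕ := if Even k then 2 * i else 2 * i - 1

/-- The first column of the rows `R^i` and `Ř^i`. -/
def startCol (k i : ℕ) : ℕ := mid k - i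

/-- The last column of the rows `R^i` and `Ř^i`; the two paths of a row of length `ℓ` have
`2ℓ + 1` vertices. -/
def endCol (k i : ℕ) : ℕ := startCol k i + 2 * rowLength k i

/-- The index `i` of the longer one of the rows next to the `p`-th path from the top; the path
consists of one of the two paths of that row. -/
def pathIndex (k p : ℕ) : ℕ := min p (2 * mid k + 1 - p)

/-- The `i`-th vertex `x_i`: the first vertex of the `i`-th path from the top. -/
def x (k i : ℕ) : ℕ × ℕ := (i, startCol k (pathIndex k i))

/-- The `i`-th vertex `y_i`: the last vertex of the `i`-th path from the bottom. -/
def y (k i : ℕ) : ℕ × ℕ :=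
  (numPaths k + 1 - i, endCol k (pathIndex k (numPaths k + 1 - i)))

/-- Names for the edges. -/
inductive Edge where
  /-- the edge of path `p` from column `c` to column `c + 1` -/
  | horizontal (p c : ℕ)
  /-- the vertical edge number `j`, counted from the left and starting with `0`, of row `r` -/
  | vertical (r j : ℕ)
  /-- the edge `x_i y_i` -/
  | chord (i : ℕ)

/-- The two ends of an edge. -/
def ends (k : ℕ) : Edge → (ℕ × ℕ) × (ℕ × ℕ)
  | .horizontal p c => ((p, c), (p, c + 1))
  | .vertical r j =>
      ((r, startCol k (rowIndex k r) + 2 * j), (r + 1, startCol k (rowIndex k r) + 2 * j))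
  | .chord i => (x k i, y k i)

/-- The vertices of the wall. -/
def vertices (k : ℕ) : Set (ℕ × ℕ) :=
  {a | a.1 ∈ Icc 1 (numPaths k) ∧
    a.2 ∈ Icc (startCol k (pathIndex k a.1)) (endCol k (pathIndex k a.1))}

/-- The edges of the wall and the edges `x_i y_i`. A row of length `ℓ` has the `ℓ + 1` vertical
edges `0, …, ℓ`; if there are more than `2 * keep` of them, then only the first `keep` and the
last `keep` ones are present. -/
def IsEdge (k : ℕ) : Edge → Prop
  | .horizontal p c => p ∈ Icc 1 (numPaths k) ∧
      c ∈ Ico (startCol k (pathIndex k p)) (endCol k (pathIndex k p))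
  | .vertical r j => r ∈ Ico 1 (numPaths k) ∧ j ≤ rowLength k (rowIndex k r) ∧
      (2 * keep k (rowIndex k r) < rowLength k (rowIndex k r) + 1 →
        j < keep k (rowIndex k r) ∨
          rowLength k (rowIndex k r) + 1 ≤ j + keep k (rowIndex k r))
  | .chord i => i ∈ Icc 1 k

theorem ends_mem {k : ℕ} {e : Edge} (he : IsEdge k e) :
    (ends k e).1 ∈ vertices k ∧ (ends k e).2 ∈ vertices k := by
  cases e <;>
  simp only [IsEdge, ends, vertices, x, y, mem_Icc, mem_Ico, mem_ofPred_eq, endCol, startCol,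
    numPaths, rowIndex, pathIndex, rowLength, mid] at he ⊢ <;>
  omega

/-- The wall of size `k` together with the edges `x_i y_i`, `1 ≤ i ≤ k`, where no vertex has been
suppressed yet. -/
def wallWithChords (k : ℕ) : Graph (ℕ × ℕ) Edge where
  vertexSet := vertices k
  IsLink e a b := IsEdge k e ∧ (ends k e = (a, b) ∨ ends k e = (b, a))
  isLink_symm _ _ := ⟨fun _ _ h => ⟨h.1, h.2.symm⟩⟩
  eq_or_eq_of_isLink_of_isLink e a b c d h h' := by
    rcases h.2 with h | h <;> rcases h'.2 with h' | h' <;> rw [h] at h' <;>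
      simp only [Prod.mk.injEq] at h' <;> tauto
  left_mem_of_isLink e a b h := by
    have := ends_mem h.1
    rcases h.2 with h | h <;> rw [h] at this
    · exact this.1
    · exact this.2

/-- The signed graph of the wall and the edges `x_i y_i`, which are its negative edges. -/
def signedWall (k : ℕ) : SignedGraph (ℕ × ℕ) Edge where
  graph := wallWithChords k
  neg := {e | ∃ i ∈ Icc 1 k, e = .chord i}
  neg_subset := by
    rintro e ⟨i, hi, rfl⟩
    exact (wallWithChords k).edge_mem_iff_exists_isLink _ |>.2
      ⟨x k i, y k i, hi, Or.inl rfl⟩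

/-- The signed graph `(E_k, Σ_k)`. For odd `k` the divalent vertices `x_{k+1}` and `y_{k+1}` of the
wall, the only ends of paths without an edge `x_i y_i`, are suppressed. -/
def escherWall (k : ℕ) : SignedGraph (ℕ × ℕ) (Set Edge) :=
  (signedWall k).suppress {a | Odd k ∧ (a = x k (k + 1) ∨ a = y k (k + 1))}

/-- The signed graph `(E_k, Σ_k)` drawn as a cubic graph: all divalent vertices are suppressed. -/
def cubicEscherWall (k : ℕ) : SignedGraph (ℕ × ℕ) (Set Edge) :=
  (signedWall k).suppress {a | a ∈ vertices k ∧ (wallWithChords k).degree a = 2}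

end Wall

/-! Signs are written in `ZMod 2`. A signed graph is balanced iff its vertices have a colouring `s`
with `s a + s b` equal to the sign of each edge `ab`, so the frustration index is the least size of
the set `bad s` of violated edges. By `isCritical_of_bad`, criticality follows if every colouring
violates at least `k` edges and every edge is violated by some colouring that violates at most `k`.
A critical signed graph without two edge-disjoint negative circuits is in `SStar k`, by
`mem_sStar_of_isCritical`, because the parts of a decomposition would contain such circuits. All of
this is proved for the wall before suppression and carried over by
`IsSuppressible.suppress_mem_sStar`; both graphs of the theorem arise by suppressing divalent
vertices of the same wall.

Lower bound (`le_encard_bad`): give each edge two copies. For each chord there is a closed walk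
through it and no other chord, built from pieces of horizontal paths and from diagonal stairs. These
`k` walks and their images under a half-turn use each copy at most once. All `2k` walks are
negative, so each contains a violated edge, whence `2k ≤ 2 |bad s|`.

Criticality (`isTight`): colour the vertices by the side of a curve that runs through the wall from
top to bottom. The violated edges are those that the curve cuts and the chords with both ends on one
side. Vertical edges occur only in columns of one parity, so diagonal curves avoid them. Curves with
exactly `k` violated edges are found through every edge.

No two disjoint negative circuits (`not_disjoint`): the chords join opposite ends of the wall as if
through a crosscap, and negative circuits are one-sided curves in the projective plane, any two of
which meet. In `ZMod 2`: disjoint even sets `Z` and `U` share no vertex since all degrees are at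
most three. If `Z` is negative, then the parity of the edges of `Z` passing above a vertex is a
potential for the signs on `U`: it is constant along positive edges of `U` and changes along its
chords. Hence `U` is not negative. -/

namespace SignedGraph

/-! ### Balance, colourings and the frustration index -/

variable {α : Type u} {β : Type v}

open Classical in
/-- The sign of an edge, written additively. -/
noncomputable def sign (G : SignedGraph α β) (e : β) : ZMod 2 := if e ∈ G.neg then 1 else 0

/-- The edges whose sign does not match the colours of their ends. -/
def bad (G : SignedGraph α β) (s : α → ZMod 2) : Set β :=
  {e | ∃ a b, G.graph.IsLink e a b ∧ s a + s b ≠ G.sign e}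

theorem bad_subset (G : SignedGraph α β) (s : α → ZMod 2) : G.bad s ⊆ G.graph.edgeSet := by
  rintro e ⟨a, b, h, -⟩
  exact h.edge_mem

theorem zmod_two_add_eq_zero {a b : ZMod 2} (h : a + b = 0) : a = b := by
  revert a b; decide

theorem zmod_two_add_self (a : ZMod 2) : a + a = 0 := by
  revert a; decide

theorem zmod_two_eq_zero_of_ne_one {a : ZMod 2} (h : a ≠ 1) : a = 0 := by
  revert a; decide

theorem sum_sign_of_injOn (G : SignedGraph α β) {n : ℕ} {e : ℕ → β} (he : InjOn e (Iio n)) :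
    (((e '' Iio n) ∩ G.neg).ncard : ZMod 2) = ∑ i ∈ Finset.range n, G.sign (e i) := by
  classical
  have h1 : (e '' Iio n) ∩ G.neg =
      (((Finset.range n).filter fun i => e i ∈ G.neg).image e : Finset β) := by
    ext b
    simp only [mem_inter_iff, mem_image, mem_Iio, Finset.coe_image, Finset.coe_filter,
      Finset.mem_range, mem_ofPred_eq]
    constructor
    · rintro ⟨⟨i, hi, rfl⟩, hb⟩
      exact ⟨i, ⟨hi, hb⟩, rfl⟩
    · rintro ⟨i, ⟨hi, hb⟩, rfl⟩
      exact ⟨⟨i, hi, rfl⟩, hb⟩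
  rw [h1, ncard_coe_finset, Finset.card_image_of_injOn]
  · simp [sign]
  · intro i hi j hj
    simp only [Finset.coe_filter, Finset.mem_range, mem_ofPred_eq] at hi hj
    exact he hi.1 hj.1

theorem isNegative_image_iff (G : SignedGraph α β) {n : ℕ} {e : ℕ → β} (he : InjOn e (Iio n)) :
    G.IsNegative (e '' Iio n) ↔ ∑ i ∈ Finset.range n, G.sign (e i) = 1 := by
  rw [IsNegative, ← ZMod.natCast_eq_one_iff_odd, sum_sign_of_injOn G he]

/-- Telescoping along a walk. -/
theorem sum_add_succ (s : ℕ → ZMod 2) (n : ℕ) :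
    ∑ i ∈ Finset.range n, (s i + s (i + 1)) = s 0 + s n := by
  induction n with
  | zero => simp [zmod_two_add_self]
  | succ n ih =>
    rw [Finset.sum_range_succ, ih]
    have := zmod_two_add_self (s n)
    linear_combination this

theorem balanced_of_potential (G : SignedGraph α β) (s : α → ZMod 2)
    (hs : ∀ e a b, G.graph.IsLink e a b → s a + s b = G.sign e) : G.Balanced := by
  rintro C ⟨n, v, e, hn, hv, he, hvn, hl, rfl⟩ hneg
  rw [isNegative_image_iff G he] at hneg
  have h1 : ∑ i ∈ Finset.range n, G.sign (e i) = ∑ i ∈ Finset.range n, (s (v i) + s (v (i + 1))) :=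
    Finset.sum_congr rfl fun i hi => (hs _ _ _ (hl i (Finset.mem_range.1 hi))).symm
  rw [h1, sum_add_succ (fun i => s (v i)), hvn, zmod_two_add_self] at hneg
  exact absurd hneg (by decide)

/-- A repeated vertex splits a closed walk into two shorter ones, one of which is still odd. With
distinct vertices an edge can repeat only in a walk of length two, and there the sum is zero. -/
theorem exists_negative_circuit (G : SignedGraph α β) (n : ℕ) : ∀ (v : ℕ → α) (e : ℕ → β),
    v n = v 0 → (∀ i < n, G.graph.IsLink (e i) (v i) (v (i + 1))) →
    ∑ i ∈ Finset.range n, G.sign (e i) = 1 → ∃ C, G.graph.IsCircuit C ∧ G.IsNegative C := by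
  induction n using Nat.strong_induction_on with
  | _ n ih =>
  intro v e hvn hl hsum
  have hn : 0 < n := by
    rcases Nat.eq_zero_or_pos n with rfl | h
    · simp at hsum
    · exact h
  by_cases hv : InjOn v (Iio n)
  · by_cases he : InjOn e (Iio n)
    · exact ⟨_, ⟨n, v, e, hn, hv, he, hvn, hl, rfl⟩, (isNegative_image_iff G he).2 hsum⟩
    · exfalso
      have key : ∀ i j, i < j → j < n → e i = e j → False := by
        intro i j hij hj hee
        have h1 := hl i (by omega)
        rw [hee] at h1
        have hne : v i ≠ v j := fun h => by
          have := hv (show i < n by omega) (show j < n from hj) h; omega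
        rcases h1.eq_and_eq_or_eq_and_eq (hl j hj) with ⟨h, -⟩ | ⟨h, h'⟩
        · exact hne h
        · have h2 : i + 1 = j := hv (show i + 1 < n by omega) (show j < n from hj) h'
          rcases Nat.lt_or_ge (j + 1) n with h3 | h3
          · have := hv (show i < n by omega) (show j + 1 < n from h3) h; omega
          · have h4 : j + 1 = n := by omega
            rw [h4, hvn] at h
            have h5 := hv (show i < n by omega) (show 0 < n by omega) h
            have h6 : n = 2 := by omega
            subst h6 h5
            obtain rfl : j = 1 := by omega
            simp only [Finset.sum_range_succ, Finset.range_zero, Finset.sum_empty, zero_add] at hsum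
            rw [hee, zmod_two_add_self] at hsum
            exact absurd hsum (by decide)
      apply he
      intro i hi j hj hee
      rcases lt_trichotomy i j with h | h | h
      · exact (key i j h hj hee).elim
      · exact h
      · exact (key j i h hi hee.symm).elim
  · have : ∃ i j, i < j ∧ j < n ∧ v i = v j := by
      by_contra hcon
      push Not at hcon
      apply hv
      intro i hi j hj hij
      rcases lt_trichotomy i j with h | h | h
      · exact (hcon i j h hj hij).elim
      · exact h
      · exact (hcon j i h hi hij.symm).elim
    obtain ⟨i, j, hij, hj, hvij⟩ := this
    obtain ⟨d, rfl⟩ : ∃ d, j = i + d := ⟨j - i, by omega⟩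
    obtain ⟨m, rfl⟩ : ∃ m, n = i + d + m := ⟨n - (i + d), by omega⟩
    have hsplit : ∑ a ∈ Finset.range (i + d + m), G.sign (e a) =
        (∑ a ∈ Finset.range d, G.sign (e (i + a))) +
        (∑ a ∈ Finset.range (i + m), G.sign (e (if a < i then a else a + d))) := by
      rw [Finset.sum_range_add, Finset.sum_range_add, Finset.sum_range_add]
      have h1 : ∑ a ∈ Finset.range i, G.sign (e (if a < i then a else a + d)) =
          ∑ a ∈ Finset.range i, G.sign (e a) :=
        Finset.sum_congr rfl fun a ha => by rw [if_pos (Finset.mem_range.1 ha)]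
      have h2 : ∑ a ∈ Finset.range m, G.sign (e (if i + a < i then i + a else i + a + d)) =
          ∑ a ∈ Finset.range m, G.sign (e (i + d + a)) :=
        Finset.sum_congr rfl fun a ha => by
          rw [if_neg (by omega)]; congr 2; omega
      rw [h1, h2]; ring
    by_cases h1 : ∑ a ∈ Finset.range d, G.sign (e (i + a)) = 1
    · exact ih d (by omega) (fun a => v (i + a)) (fun a => e (i + a)) (by simpa using hvij.symm)
        (fun a ha => hl (i + a) (by omega)) h1
    · rw [hsplit, zmod_two_eq_zero_of_ne_one h1, zero_add] at hsum
      refine ih (i + m) (by omega) (fun a => if a < i then v a else v (a + d))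
        (fun a => e (if a < i then a else a + d)) ?_ ?_ hsum
      · rcases Nat.eq_zero_or_pos i with rfl | hi
        · simp only [Nat.not_lt_zero, if_false, zero_add] at hvij ⊢
          rw [← hvij, ← hvn]; congr 1; omega
        · simp only [hi, if_true, ← hvn]
          rw [if_neg (by omega)]; congr 1; omega
      · intro a ha
        rcases lt_trichotomy (a + 1) i with h | h | h
        · rw [if_pos (by omega), if_pos (by omega), if_pos h]
          exact hl a (by omega)
        · rw [if_pos (by omega), if_pos (by omega), if_neg (by omega), h, ← hvij, ← h]
          exact hl a (by omega)
        · rw [if_neg (by omega), if_neg (by omega), if_neg (by omega),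
            show a + 1 + d = a + d + 1 by omega]
          exact hl (a + d) (by omega)

/-- Walks with the sum of the signs of their edges. -/
inductive SignedWalk (G : SignedGraph α β) : α → α → ZMod 2 → Prop
  | nil (a : α) : SignedWalk G a a 0
  | cons {a b c : α} {t : ZMod 2} (e : β) (h : G.graph.IsLink e a b) (w : SignedWalk G b c t) :
      SignedWalk G a c (G.sign e + t)

theorem SignedWalk.trans {G : SignedGraph α β} {a b c : α} {t t' : ZMod 2}
    (h : G.SignedWalk a b t) (h' : G.SignedWalk b c t') : G.SignedWalk a c (t + t') := by
  induction h with
  | nil => simpa using h'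
  | cons e h _ ih => rw [add_assoc]; exact .cons e h (ih h')

theorem SignedWalk.symm {G : SignedGraph α β} {a b : α} {t : ZMod 2}
    (h : G.SignedWalk a b t) : G.SignedWalk b a t := by
  induction h with
  | nil => exact .nil _
  | cons e h _ ih =>
    rw [add_comm]
    have := ih.trans (.cons e h.symm (.nil _))
    simpa using this

theorem SignedWalk.exists_seq [Nonempty β] {G : SignedGraph α β} {a b : α} {t : ZMod 2}
    (h : G.SignedWalk a b t) : ∃ (n : ℕ) (v : ℕ → α) (e : ℕ → β), v 0 = a ∧ v n = b ∧
      (∀ i < n, G.graph.IsLink (e i) (v i) (v (i + 1))) ∧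
      ∑ i ∈ Finset.range n, G.sign (e i) = t := by
  induction h with
  | nil a => exact ⟨0, fun _ => a, fun _ => Classical.arbitrary β, rfl, rfl, by simp, by simp⟩
  | @cons a b c t e h _ ih =>
    obtain ⟨n, v, f, h0, hn, hl, hs⟩ := ih
    refine ⟨n + 1, fun i => if i = 0 then a else v (i - 1), fun i => if i = 0 then e else f (i - 1),
      by simp, by simpa using hn, ?_, ?_⟩
    · rintro (_ | i) hi
      · simpa [h0] using h
      · simpa using hl i (by omega)
    · rw [Finset.sum_range_succ']
      simp only [Nat.add_eq_zero_iff, one_ne_zero, and_false, if_false, Nat.add_sub_cancel, if_true,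
        hs]
      ring

/-- A balanced signed graph is switching equivalent to an all-positive one. -/
theorem Balanced.exists_potential {G : SignedGraph α β} (hG : G.Balanced) :
    ∃ s : α → ZMod 2, ∀ e a b, G.graph.IsLink e a b → s a + s b = G.sign e := by
  rcases isEmpty_or_nonempty β with hβ | hβ
  · exact ⟨fun _ => 0, fun e => hβ.elim e⟩
  have hclosed : ∀ a t, G.SignedWalk a a t → t = 0 := by
    intro a t h
    apply zmod_two_eq_zero_of_ne_one
    rintro rfl
    obtain ⟨n, v, e, h0, hn, hl, hs⟩ := h.exists_seq
    obtain ⟨C, hC, hC'⟩ := G.exists_negative_circuit n v e (hn.trans h0.symm) hl hs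
    exact hG C hC hC'
  let S : Setoid α := ⟨fun a b => ∃ t, G.SignedWalk a b t, fun a => ⟨0, .nil a⟩,
    fun ⟨t, h⟩ => ⟨t, h.symm⟩, fun ⟨t, h⟩ ⟨t', h'⟩ => ⟨t + t', h.trans h'⟩⟩
  -- The potential of a vertex is the sign of a walk from a chosen vertex of its component; the
  -- choice of walk does not matter, by `hclosed`.
  have hroot : ∀ a : α, ∃ t, G.SignedWalk (Quotient.mk S a).out a t :=
    fun a => Quotient.mk_out (s := S) a
  choose s hs using hroot
  refine ⟨s, fun e a b h => ?_⟩
  have hab : Quotient.mk S a = Quotient.mk S b := Quotient.sound ⟨_, .cons e h (.nil b)⟩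
  have h1 := hs b
  rw [← hab] at h1
  have := hclosed _ _ (((hs a).trans (.cons e h (.nil b))).trans h1.symm)
  apply zmod_two_add_eq_zero
  linear_combination this

theorem sign_deleteEdges (G : SignedGraph α β) {F : Set β} {e : β} (he : e ∉ F) :
    (G.deleteEdges F).sign e = G.sign e := by
  have h : e ∈ (G.deleteEdges F).neg ↔ e ∈ G.neg := ⟨And.left, fun h => ⟨h, he⟩⟩
  by_cases hG : e ∈ G.neg
  · rw [sign, sign, if_pos hG, if_pos (h.2 hG)]
  · rw [sign, sign, if_neg hG, if_neg fun h' => hG (h.1 h')]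

theorem balanced_deleteEdges_of_bad_subset (G : SignedGraph α β) (s : α → ZMod 2) {F : Set β}
    (hF : G.bad s ⊆ F) : (G.deleteEdges F).Balanced := by
  apply balanced_of_potential _ s
  intro e a b h
  rw [deleteEdges, Graph.deleteEdges_isLink] at h
  rw [sign_deleteEdges G h.2]
  by_contra hcon
  exact h.2 (hF ⟨a, b, h.1, hcon⟩)

theorem exists_bad_subset_of_balanced (G : SignedGraph α β) {F : Set β}
    (hF : (G.deleteEdges F).Balanced) : ∃ s : α → ZMod 2, G.bad s ⊆ F := by
  obtain ⟨s, hs⟩ := hF.exists_potential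
  refine ⟨s, ?_⟩
  rintro e ⟨a, b, h, hne⟩
  by_contra he
  apply hne
  rw [← sign_deleteEdges G he]
  exact hs e a b (by rw [deleteEdges, Graph.deleteEdges_isLink]; exact ⟨h, he⟩)

/-- Every set whose deletion balances the graph contains some `bad s`; together with
`frustrationIndex_le` this makes the index the minimum of `|bad s|`. -/
theorem le_frustrationIndex (G : SignedGraph α β) {k : ℕ∞} (h : ∀ s, k ≤ (G.bad s).encard) :
    k ≤ G.frustrationIndex := by
  apply le_sInf
  rintro _ ⟨F, ⟨-, hF⟩, rfl⟩
  obtain ⟨s, hs⟩ := G.exists_bad_subset_of_balanced hF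
  exact (h s).trans (encard_le_encard hs)

theorem frustrationIndex_le (G : SignedGraph α β) {s : α → ZMod 2} {F : Set β}
    (h : G.bad s ⊆ F) (hF : F ⊆ G.graph.edgeSet) : G.frustrationIndex ≤ F.encard :=
  sInf_le ⟨F, ⟨hF, G.balanced_deleteEdges_of_bad_subset s h⟩, rfl⟩

theorem bad_deleteEdges_subset (G : SignedGraph α β) (F : Set β) (s : α → ZMod 2) :
    (G.deleteEdges F).bad s ⊆ G.bad s \ F := by
  rintro e ⟨a, b, h, hne⟩
  rw [deleteEdges, Graph.deleteEdges_isLink] at h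
  rw [sign_deleteEdges G h.2] at hne
  exact ⟨⟨a, b, h.1, hne⟩, h.2⟩

/-- Criticality in terms of colourings of the vertices. -/
theorem isCritical_of_bad (G : SignedGraph α β) {k : ℕ} (hk : 1 ≤ k)
    (hlower : ∀ s, (k : ℕ∞) ≤ (G.bad s).encard) (hupper : ∃ s, (G.bad s).encard ≤ k)
    (hedge : ∀ e ∈ G.graph.edgeSet, ∃ s, (G.bad s \ {e}).encard < k) : G.IsCritical k := by
  refine ⟨hk, le_antisymm ?_ (G.le_frustrationIndex hlower), fun e he => ?_⟩
  · obtain ⟨s, hs⟩ := hupper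
    exact (G.frustrationIndex_le Subset.rfl (G.bad_subset s)).trans hs
  · obtain ⟨s, hs⟩ := hedge e he
    refine ((G.deleteEdges {e}).frustrationIndex_le (bad_deleteEdges_subset G {e} s) ?_).trans_lt hs
    intro f hf
    rw [deleteEdges, Graph.edgeSet_deleteEdges]
    exact ⟨G.bad_subset s hf.1, hf.2⟩

theorem IsCritical.exists_negative_circuit {G : SignedGraph α β} {k : ℕ} (h : G.IsCritical k) :
    ∃ C, G.graph.IsCircuit C ∧ G.IsNegative C := by
  by_contra hcon
  push Not at hcon
  have h0 : G.frustrationIndex ≤ 0 := by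
    have h1 : (G.deleteEdges ∅).Balanced := by
      have h2 : G.deleteEdges ∅ = G := by
        simp [deleteEdges]
      rw [h2]
      exact hcon
    have h3 : G.frustrationIndex ≤ (∅ : Set β).encard :=
      sInf_le ⟨∅, ⟨empty_subset _, h1⟩, rfl⟩
    simpa using h3
  rw [h.2.1] at h0
  have := h.1
  simp at h0
  omega

theorem IsSubgraph.trans {G H K : SignedGraph α β} (h : K.IsSubgraph H) (h' : H.IsSubgraph G) :
    K.IsSubgraph G := by
  refine ⟨h.1.trans h'.1, ?_⟩
  rw [h.2, h'.2, inter_assoc, inter_eq_self_of_subset_right (Graph.IsSubgraph.edgeSet_mono h.1)]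

theorem IsCircuit.subset_edgeSet {G : Graph α β} {C : Set β} (hC : G.IsCircuit C) :
    C ⊆ G.edgeSet := by
  obtain ⟨n, v, e, -, -, -, -, hl, rfl⟩ := hC
  rintro _ ⟨i, hi, rfl⟩
  exact (hl i hi).edge_mem

theorem IsCircuit.mono {G H : Graph α β} (h : H ≤ G) {C : Set β} (hC : H.IsCircuit C) :
    G.IsCircuit C := by
  obtain ⟨n, v, e, hn, hv, he, hvn, hl, rfl⟩ := hC
  exact ⟨n, v, e, hn, hv, he, hvn, fun i hi => (hl i hi).mono h, rfl⟩

theorem IsSubgraph.isNegative_iff {G H : SignedGraph α β} (h : H.IsSubgraph G) {C : Set β}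
    (hC : C ⊆ H.graph.edgeSet) : H.IsNegative C ↔ G.IsNegative C := by
  rw [IsNegative, IsNegative, h.2, inter_left_comm, inter_eq_self_of_subset_left hC, inter_comm]

/-- A critical signed graph without two edge-disjoint negative circuits is in `S*`. -/
theorem mem_sStar_of_isCritical {G : SignedGraph α β} {k : ℕ} (h : G.IsCritical k)
    (hcirc : ∀ C C', G.graph.IsCircuit C → G.graph.IsCircuit C' → G.IsNegative C →
      G.IsNegative C' → ¬ Disjoint C C') : G ∈ SStar k := by
  refine ⟨h, ?_⟩
  rintro m - H hHG - ⟨n, c, K, hn, -, hK, hdisj⟩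
  -- Critical graphs have positive index, so each part is unbalanced; two parts suffice for the
  -- contradiction.
  have key : ∀ i, ∃ C, G.graph.IsCircuit C ∧ G.IsNegative C ∧ C ⊆ (K i).graph.edgeSet := by
    intro i
    obtain ⟨C, hC, hneg⟩ := (hK i).2.exists_negative_circuit
    have hsub := (hK i).1.trans hHG
    have hCs := IsCircuit.subset_edgeSet hC
    exact ⟨C, IsCircuit.mono hsub.1 hC, (hsub.isNegative_iff hCs).1 hneg, hCs⟩
  obtain ⟨C, hC, hneg, hs⟩ := key ⟨0, by omega⟩
  obtain ⟨C', hC', hneg', hs'⟩ := key ⟨1, by omega⟩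
  exact hcirc C C' hC hC' hneg hneg'
    ((hdisj (show (⟨0, by omega⟩ : Fin n) ≠ ⟨1, by omega⟩ by simp)).mono hs hs')

end SignedGraph

/-! ### Threads through divalent vertices -/

namespace SignedGraph

variable {α : Type u} {β : Type v}

/-- The vertices in `D` are divalent; they are the non-roots of a forest of positive edges `up d`
joining `d` to `parent d`, and every other edge has an end of larger rank outside `D`. -/
structure IsSuppressible (G : SignedGraph α β) (D : Set α) (parent : α → α) (up : α → β)
    (rank : α → ℕ) : Prop where
  link : ∀ d ∈ D, G.graph.IsLink (up d) d (parent d)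
  rank_parent : ∀ d ∈ D, rank (parent d) < rank d
  rank_bound : ∃ B, ∀ d ∈ D, rank d ≤ B
  inc : ∀ d ∈ D, ∃ o, o ≠ up d ∧ G.graph.Inc o d ∧ ∀ e, G.graph.Inc e d → e = up d ∨ e = o
  up_notMem : ∀ d ∈ D, up d ∉ G.neg
  other : ∀ e a b, G.graph.IsLink e a b → e ∉ up '' D → a ∈ D → b ∉ D ∧ rank a < rank b
  loopless : ∀ e a, ¬ G.graph.IsLink e a a

namespace IsSuppressible

variable {G : SignedGraph α β} {D : Set α} {parent : α → α} {up : α → β} {rank : α → ℕ}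

theorem up_injOn (h : G.IsSuppressible D parent up rank) : InjOn up D := by
  intro d hd d' hd' hdd
  have h1 := h.link d hd
  rw [hdd] at h1
  rcases h1.eq_and_eq_or_eq_and_eq (h.link d' hd') with ⟨h2, -⟩ | ⟨h2, h3⟩
  · exact h2
  · have h4 := h.rank_parent d hd
    have h5 := h.rank_parent d' hd'
    rw [h3] at h4
    rw [← h2] at h5
    omega

theorem exists_iterate_notMem (h : G.IsSuppressible D parent up rank) (a : α) :
    ∃ n, parent^[n] a ∉ D := by
  by_contra hcon
  push Not at hcon
  have : ∀ n, rank (parent^[n] a) + n ≤ rank a := by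
    intro n
    induction n with
    | zero => simp
    | succ n ih =>
      have := h.rank_parent _ (hcon n)
      rw [Function.iterate_succ_apply']
      omega
  have := this (rank a + 1)
  omega

open Classical in
/-- The number of steps to the root. -/
noncomputable def depth (h : G.IsSuppressible D parent up rank) (a : α) : ℕ :=
  Nat.find (h.exists_iterate_notMem a)

/-- The first vertex outside `D` on the way up. -/
noncomputable def root (h : G.IsSuppressible D parent up rank) (a : α) : α :=
  parent^[h.depth a] a

theorem root_notMem (h : G.IsSuppressible D parent up rank) (a : α) : h.root a ∉ D := by
  classical
  exact Nat.find_spec (h.exists_iterate_notMem a)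

theorem iterate_mem (h : G.IsSuppressible D parent up rank) {a : α} {i : ℕ} (hi : i < h.depth a) :
    parent^[i] a ∈ D := by
  classical
  exact not_not.1 (Nat.find_min (h.exists_iterate_notMem a) hi)

theorem depth_of_notMem (h : G.IsSuppressible D parent up rank) {a : α} (ha : a ∉ D) :
    h.depth a = 0 := by
  classical
  exact (Nat.find_eq_zero _).2 ha

theorem root_of_notMem (h : G.IsSuppressible D parent up rank) {a : α} (ha : a ∉ D) :
    h.root a = a := by
  rw [root, h.depth_of_notMem ha, Function.iterate_zero_apply]

theorem depth_of_mem (h : G.IsSuppressible D parent up rank) {a : α} (ha : a ∈ D) :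
    h.depth a = h.depth (parent a) + 1 := by
  classical
  exact Nat.find_comp_succ (h.exists_iterate_notMem a) (h.exists_iterate_notMem (parent a))
    (by simpa using ha)

theorem root_parent (h : G.IsSuppressible D parent up rank) {a : α} (ha : a ∈ D) :
    h.root (parent a) = h.root a := by
  rw [root, root, h.depth_of_mem ha, Function.iterate_succ_apply]

theorem rank_iterate (h : G.IsSuppressible D parent up rank) (a : α) {i j : ℕ} (hij : i < j)
    (hj : j ≤ h.depth a) : rank (parent^[j] a) < rank (parent^[i] a) := by
  induction j with
  | zero => omega
  | succ j ih =>
    have h1 := h.rank_parent _ (h.iterate_mem (show j < h.depth a by omega))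
    rw [Function.iterate_succ_apply']
    rcases Nat.lt_or_ge i j with h2 | h2
    · have := ih h2 (by omega)
      omega
    · obtain rfl : i = j := by omega
      exact h1

theorem rank_root_lt (h : G.IsSuppressible D parent up rank) {a : α} (ha : a ∈ D) :
    rank (h.root a) < rank a :=
  h.rank_iterate a (i := 0) (by rw [h.depth_of_mem ha]; omega) le_rfl

/-- The path which becomes one edge. -/
theorem exists_isThread (h : G.IsSuppressible D parent up rank) {e : β} {a b : α}
    (he : G.graph.IsLink e a b) (heD : e ∉ up '' D) (ha : a ∉ D) :
    ∃ F, G.graph.IsThread D F a (h.root b) ∧ e ∈ F ∧ F ⊆ insert e (up '' D) ∧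
      ∀ i < h.depth b, up (parent^[i] b) ∈ F := by
  refine ⟨(fun i => if i = 0 then e else up (parent^[i - 1] b)) '' Iio (h.depth b + 1),
    ⟨ha, h.root_notMem b, h.depth b + 1, fun i => if i = 0 then a else parent^[i - 1] b, _,
      Nat.succ_pos _, rfl, by simp [root], ?_, ?_, ?_, ?_, rfl⟩, ⟨0, by simp, rfl⟩, ?_, ?_⟩
  · rintro i ⟨h1, h2⟩
    simp only [h1.ne', if_false]
    exact h.iterate_mem (by omega)
  · rintro i ⟨h1, h2⟩ j ⟨h3, h4⟩ hij
    simp only [h1.ne', h3.ne', if_false] at hij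
    rcases lt_trichotomy i j with hlt | hlt | hlt
    · have := h.rank_iterate b (show i - 1 < j - 1 by omega) (by omega)
      rw [hij] at this; omega
    · exact hlt
    · have := h.rank_iterate b (show j - 1 < i - 1 by omega) (by omega)
      rw [hij] at this; omega
  · rintro (_ | i) hi (_ | j) hj hij
    · rfl
    · simp only [mem_Iio] at hi hj
      simp only [if_true, Nat.add_eq_zero_iff, one_ne_zero, and_false, if_false,
        Nat.add_sub_cancel] at hij
      exact (heD ⟨_, h.iterate_mem (by omega), hij.symm⟩).elim
    · simp only [mem_Iio] at hi hj
      simp only [if_true, Nat.add_eq_zero_iff, one_ne_zero, and_false, if_false,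
        Nat.add_sub_cancel] at hij
      exact (heD ⟨_, h.iterate_mem (by omega), hij⟩).elim
    · simp only [mem_Iio] at hi hj
      simp only [Nat.add_eq_zero_iff, one_ne_zero, and_false, if_false,
        Nat.add_sub_cancel] at hij
      have hij := h.up_injOn (h.iterate_mem (by omega)) (h.iterate_mem (by omega)) hij
      rcases lt_trichotomy i j with hlt | hlt | hlt
      · have := h.rank_iterate b hlt (by omega)
        rw [hij] at this; omega
      · omega
      · have := h.rank_iterate b hlt (by omega)
        rw [hij] at this; omega
  · rintro (_ | i) hi
    · simpa using he
    · have := h.link _ (h.iterate_mem (show i < h.depth b by omega))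
      rw [← Function.iterate_succ_apply' parent i b] at this
      simpa using this
  · rintro _ ⟨i | i, hi, rfl⟩
    · exact mem_insert _ _
    · simp only [mem_Iio] at hi
      exact mem_insert_of_mem _ ⟨_, h.iterate_mem (a := b) (show i < _ by omega), by simp⟩
  · intro i hi
    exact ⟨i + 1, by simpa using hi, by simp⟩

/-- A vertex of `D` on a thread is an inner vertex, where the thread uses two distinct edges; a
divalent vertex has no others. -/
theorem inc_mem_of_isThread (h : G.IsSuppressible D parent up rank) {F : Set β} {x y d : α}
    (hF : G.graph.IsThread D F x y) (hd : d ∈ D) {f g : β} (hf : f ∈ F) (hfd : G.graph.Inc f d)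
    (hg : G.graph.Inc g d) : g ∈ F := by
  obtain ⟨hx, hy, n, v, e, hn, rfl, rfl, hD, hv, he, hl, rfl⟩ := hF
  obtain ⟨j, hj, rfl⟩ := hf
  have key : ∃ m, 0 < m ∧ m < n ∧ v m = d := by
    rcases hfd.eq_or_eq_of_isLink (hl j hj) with h1 | h1
    · refine ⟨j, Nat.pos_of_ne_zero ?_, hj, h1.symm⟩
      rintro rfl; exact hx (h1 ▸ hd)
    · refine ⟨j + 1, Nat.succ_pos _, lt_of_le_of_ne hj ?_, h1.symm⟩
      rintro h2; rw [← h2] at hy; exact hy (h1 ▸ hd)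
  obtain ⟨m, hm, hmn, rfl⟩ := key
  obtain ⟨o, -, -, ho⟩ := h.inc _ hd
  have h1 : G.graph.Inc (e m) (v m) := (hl m hmn).inc_left
  have h2 : G.graph.Inc (e (m - 1)) (v m) := by
    have := (hl (m - 1) (by omega)).inc_right
    rwa [Nat.sub_add_cancel hm] at this
  have h3 : e m ≠ e (m - 1) := fun hc => by
    have := he (show m < n from hmn) (show m - 1 < n by omega) hc; omega
  have m1 : e m ∈ e '' Iio n := ⟨m, hmn, rfl⟩
  have m2 : e (m - 1) ∈ e '' Iio n := ⟨m - 1, show m - 1 < n by omega, rfl⟩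
  rcases ho _ h1 with a1 | a1 <;> rcases ho _ h2 with a2 | a2 <;> rcases ho _ hg with a3 | a3
  · exact absurd (a1.trans a2.symm) h3
  · exact absurd (a1.trans a2.symm) h3
  · rw [a3, ← a1]; exact m1
  · rw [a3, ← a2]; exact m2
  · rw [a3, ← a2]; exact m2
  · rw [a3, ← a1]; exact m1
  · exact absurd (a1.trans a2.symm) h3
  · exact absurd (a1.trans a2.symm) h3

/-- From the common edge, `F` is forced to stay in `F'` in both directions, since each inner vertex
offers only one continuation. -/
theorem thread_subset (h : G.IsSuppressible D parent up rank) {F F' : Set β} {x y x' y' : α}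
    (hF : G.graph.IsThread D F x y) (hF' : G.graph.IsThread D F' x' y') {f : β} (hf : f ∈ F)
    (hf' : f ∈ F') : F ⊆ F' := by
  have hF1 := hF
  obtain ⟨hx, hy, n, v, e, hn, rfl, rfl, hD, hv, he, hl, rfl⟩ := hF
  obtain ⟨i, hi, rfl⟩ := hf
  simp only [mem_Iio] at hi
  have hup : ∀ a, i + a < n → e (i + a) ∈ F' := by
    intro a
    induction a with
    | zero => intro _; exact hf'
    | succ a ih =>
      intro ha
      have h1 := ih (by omega)
      exact h.inc_mem_of_isThread hF' (hD (i + a + 1) ⟨by omega, by omega⟩) h1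
        (hl (i + a) (by omega)).inc_right (hl (i + a + 1) (by omega)).inc_left
  have hdown : ∀ a, a ≤ i → e (i - a) ∈ F' := by
    intro a
    induction a with
    | zero => intro _; exact hf'
    | succ a ih =>
      intro ha
      have h1 := ih (by omega)
      have h2 := (hl (i - (a + 1)) (by omega)).inc_right
      rw [show i - (a + 1) + 1 = i - a by omega] at h2
      exact h.inc_mem_of_isThread hF' (hD (i - a) ⟨by omega, by omega⟩) h1
        (hl (i - a) (by omega)).inc_left h2
  rintro _ ⟨j, hj, rfl⟩
  simp only [mem_Iio] at hj
  rcases Nat.lt_or_ge j i with h1 | h1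
  · have := hdown (i - j) (by omega)
    rwa [show i - (i - j) = j by omega] at this
  · have := hup (j - i) (by omega)
    rwa [show i + (j - i) = j by omega] at this

theorem thread_eq (h : G.IsSuppressible D parent up rank) {F F' : Set β} {x y x' y' : α}
    (hF : G.graph.IsThread D F x y) (hF' : G.graph.IsThread D F' x' y') {f : β} (hf : f ∈ F)
    (hf' : f ∈ F') : F = F' :=
  (h.thread_subset hF hF' hf hf').antisymm (h.thread_subset hF' hF hf' hf)

/-- A thread starts outside `D`, so if it had only forest edges, it would traverse all of them away
from the root and end in `D`. -/
theorem exists_notMem_of_isThread {F : Set β} {x y : α}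
    (h : G.IsSuppressible D parent up rank) (hF : G.graph.IsThread D F x y) :
    ∃ e ∈ F, e ∉ up '' D := by
  obtain ⟨hx, hy, n, v, e, hn, rfl, rfl, hD, hv, he, hl, rfl⟩ := hF
  by_contra hcon
  push Not at hcon
  have key : ∀ i < n, v (i + 1) ∈ D ∧ e i = up (v (i + 1)) := by
    intro i
    induction i with
    | zero =>
      intro hi
      obtain ⟨d, hd, hde⟩ := hcon _ ⟨0, hi, rfl⟩
      have h1 := h.link d hd
      rw [hde] at h1
      rcases h1.inc_left.eq_or_eq_of_isLink (hl 0 hi) with h2 | h2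
      · exact (hx (h2 ▸ hd)).elim
      · exact ⟨h2 ▸ hd, by rw [← h2, hde]⟩
    | succ i ih =>
      intro hi
      have h3 := ih (by omega)
      obtain ⟨d, hd, hde⟩ := hcon _ ⟨i + 1, hi, rfl⟩
      have h1 := h.link d hd
      rw [hde] at h1
      rcases h1.inc_left.eq_or_eq_of_isLink (hl (i + 1) hi) with h2 | h2
      · rw [h2, ← h3.2] at hde
        have := he (show i < n by omega) (show i + 1 < n from hi) hde
        omega
      · exact ⟨h2 ▸ hd, by rw [← h2, hde]⟩
  have := (key (n - 1) (by omega)).1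
  rw [Nat.sub_add_cancel hn] at this
  exact hy this

theorem exists_link_of_notMem (h : G.IsSuppressible D parent up rank) {e : β}
    (he : e ∈ G.graph.edgeSet) (heD : e ∉ up '' D) : ∃ a b, G.graph.IsLink e a b ∧ a ∉ D := by
  obtain ⟨a, b, hab⟩ := Graph.exists_isLink_of_mem_edgeSet he
  by_cases ha : a ∈ D
  · exact ⟨b, a, hab.symm, (h.other e a b hab heD ha).1⟩
  · exact ⟨a, b, hab, ha⟩

theorem subset_edgeSet_of_isThread {F : Set β} {x y : α} (hF : G.graph.IsThread D F x y) :
    F ⊆ G.graph.edgeSet := by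
  obtain ⟨hx, hy, n, v, e, hn, rfl, rfl, hD, hv, he, hl, rfl⟩ := hF
  rintro _ ⟨i, hi, rfl⟩
  exact (hl i hi).edge_mem

/-- A thread consists of an edge `e = ab` outside the forest, with `a ∉ D`, and the way from `b` up
to its root. Rank falls from `a` to `b` and on to the root if `b ∈ D`; otherwise looplessness
applies. -/
theorem ends_ne (h : G.IsSuppressible D parent up rank) {F : Set β} {x y : α}
    (hF : G.graph.IsThread D F x y) : x ≠ y := by
  obtain ⟨e, he, heD⟩ := h.exists_notMem_of_isThread hF
  obtain ⟨a, b, hab, ha⟩ := h.exists_link_of_notMem (subset_edgeSet_of_isThread hF he) heD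
  obtain ⟨F', hF', heF', -, -⟩ := h.exists_isThread hab heD ha
  rw [← h.thread_eq hF hF' he heF'] at hF'
  have hne : a ≠ h.root b := by
    by_cases hb : b ∈ D
    · have h1 := h.rank_root_lt hb
      have h2 := (h.other e b a hab.symm heD hb).2
      rintro rfl
      omega
    · rw [h.root_of_notMem hb]
      rintro rfl
      exact h.loopless _ _ hab
  rcases Graph.IsLink.eq_and_eq_or_eq_and_eq (G := G.graph.suppress D) hF hF' with
    ⟨h1, h2⟩ | ⟨h1, h2⟩
  · rw [h1, h2]; exact hne
  · rw [h1, h2]; exact hne.symm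

end IsSuppressible

end SignedGraph

/-! ### Transfer of violated edges, circuits and degrees through suppression -/

namespace SignedGraph

variable {α : Type u} {β : Type v}

open Classical in
/-- The indicator of a vertex modulo two. -/
noncomputable def vind (a z : α) : ZMod 2 := if a = z then 1 else 0

/-- `bd` is the boundary map of the graph modulo two. -/
def IsBoundary (G : Graph α β) (bd : β → α → ZMod 2) : Prop :=
  ∀ e a b, G.IsLink e a b → ∀ z, bd e z = vind a z + vind b z

theorem sign_suppress (G : SignedGraph α β) {D : Set α} {F : Set β} {x y : α}
    (hF : G.graph.IsThread D F x y) {n : ℕ} {e : ℕ → β} (he : InjOn e (Iio n))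
    (hFe : F = e '' Iio n) :
    (G.suppress D).sign F = ∑ i ∈ Finset.range n, G.sign (e i) := by
  have h1 : F ∈ (G.suppress D).neg ↔ ∑ i ∈ Finset.range n, G.sign (e i) = 1 := by
    rw [← G.isNegative_image_iff he, ← hFe]
    exact ⟨fun h => h.2, fun h => ⟨Graph.IsLink.edge_mem (G := G.graph.suppress D) hF, h⟩⟩
  by_cases h : F ∈ (G.suppress D).neg
  · rw [sign, if_pos h, h1.1 h]
  · rw [sign, if_neg h, zmod_two_eq_zero_of_ne_one fun h' => h (h1.2 h')]

theorem mem_of_mem_bad_suppress (G : SignedGraph α β) {D : Set α} {F : Set β}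
    {s : α → ZMod 2} (hF : F ∈ (G.suppress D).bad s) :
    (∃ x y, G.graph.IsThread D F x y) ∧ ∃ e ∈ F, e ∈ G.bad s := by
  obtain ⟨x, y, hl, hne⟩ := hF
  have hF : G.graph.IsThread D F x y := hl
  refine ⟨⟨x, y, hF⟩, ?_⟩
  by_contra hcon
  push Not at hcon
  obtain ⟨hx, hy, n, v, e, hn, h0, hn', hD, hv, he, hl', hFe⟩ := id hF
  apply hne
  rw [G.sign_suppress hF he hFe, ← h0, ← hn', ← sum_add_succ (fun i => s (v i))]
  refine Finset.sum_congr rfl fun i hi => ?_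
  have hi := Finset.mem_range.1 hi
  by_contra h1
  exact hcon (e i) (hFe ▸ ⟨i, hi, rfl⟩) ⟨_, _, hl' i hi, h1⟩

/-- The edges of a thread have the ends of the thread as boundary. -/
theorem exists_finset_of_isThread (G : SignedGraph α β) {D : Set α} {F : Set β} {x y : α}
    (hF : G.graph.IsThread D F x y) {bd : β → α → ZMod 2} (hbd : IsBoundary G.graph bd) :
    ∃ S : Finset β, (S : Set β) = F ∧ (∀ z, ∑ b ∈ S, bd b z = vind x z + vind y z) ∧
      ∑ b ∈ S, G.sign b = (G.suppress D).sign F := by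
  classical
  obtain ⟨hx, hy, n, v, e, hn, h0, hn', hD, hv, he, hl, hFe⟩ := id hF
  have hinj : InjOn e (Finset.range n : Finset ℕ) := by simpa using he
  refine ⟨(Finset.range n).image e, by rw [hFe]; simp, fun z => ?_, ?_⟩
  · rw [Finset.sum_image hinj, ← h0, ← hn', ← sum_add_succ (fun i => vind (v i) z)]
    exact Finset.sum_congr rfl fun i hi => hbd _ _ _ (hl i (Finset.mem_range.1 hi)) z
  · rw [Finset.sum_image hinj, G.sign_suppress hF he hFe]

namespace IsSuppressible

variable {G : SignedGraph α β} {D : Set α} {parent : α → α} {up : α → β} {rank : α → ℕ}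

/-- The threads of the circuit are disjoint and their boundaries telescope. The union is kept only
as an even set; nothing later needs it to be a circuit. -/
theorem exists_finset_of_isCircuit (h : G.IsSuppressible D parent up rank)
    {bd : β → α → ZMod 2} (hbd : IsBoundary G.graph bd) {C : Set (Set β)}
    (hC : (G.graph.suppress D).IsCircuit C) (hneg : (G.suppress D).IsNegative C) :
    ∃ U : Finset β, (U : Set β) ⊆ G.graph.edgeSet ∧ (∀ z, ∑ b ∈ U, bd b z = 0) ∧
      ∑ b ∈ U, G.sign b = 1 ∧ ∀ b ∈ U, ∃ F ∈ C, b ∈ F := by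
  classical
  obtain ⟨n, v, e, hn, hv, he, hvn, hl, rfl⟩ := hC
  rw [isNegative_image_iff _ he] at hneg
  have hthr : ∀ i, i < n → G.graph.IsThread D (e i) (v i) (v (i + 1)) := hl
  have key : ∀ i, ∃ S : Finset β, i < n → (S : Set β) = e i ∧
      (∀ z, ∑ b ∈ S, bd b z = vind (v i) z + vind (v (i + 1)) z) ∧
      ∑ b ∈ S, G.sign b = (G.suppress D).sign (e i) := by
    intro i
    by_cases hi : i < n
    · obtain ⟨S, hS⟩ := G.exists_finset_of_isThread (hthr i hi) hbd
      exact ⟨S, fun _ => hS⟩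
    · exact ⟨∅, fun hi' => (hi hi').elim⟩
  choose S hS using key
  have hdisj : ((Finset.range n : Finset ℕ) : Set ℕ).PairwiseDisjoint S := by
    intro i hi j hj hij
    simp only [Finset.coe_range, mem_Iio] at hi hj
    rw [Function.onFun, Finset.disjoint_left]
    intro b hb hb'
    apply hij
    apply he hi hj
    refine h.thread_eq (hthr i hi) (hthr j hj) (f := b) ?_ ?_
    · rw [← (hS i hi).1]; exact hb
    · rw [← (hS j hj).1]; exact hb'
  refine ⟨(Finset.range n).biUnion S, ?_, fun z => ?_, ?_, ?_⟩
  · intro b hb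
    simp only [Finset.coe_biUnion, Finset.coe_range, mem_iUnion, mem_Iio] at hb
    obtain ⟨i, hi, hb⟩ := hb
    rw [(hS i hi).1] at hb
    exact subset_edgeSet_of_isThread (hthr i hi) hb
  · rw [Finset.sum_biUnion hdisj, Finset.sum_congr rfl fun i hi =>
      (hS i (Finset.mem_range.1 hi)).2.1 z, sum_add_succ (fun i => vind (v i) z), hvn,
      zmod_two_add_self]
  · rw [Finset.sum_biUnion hdisj, Finset.sum_congr rfl fun i hi =>
      (hS i (Finset.mem_range.1 hi)).2.2]
    exact hneg
  · intro b hb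
    rw [Finset.mem_biUnion] at hb
    obtain ⟨i, hi, hb⟩ := hb
    have hi := Finset.mem_range.1 hi
    refine ⟨e i, ⟨i, hi, rfl⟩, ?_⟩
    rw [← (hS i hi).1]; exact hb

/-- Each vertex takes the colour of its root. Forest edges are positive and join equal colours, so
in each thread at most the one edge outside the forest is violated, and only if the thread is. -/
theorem exists_encard_le (h : G.IsSuppressible D parent up rank) (s' : α → ZMod 2) :
    ∃ s, (G.bad s).encard ≤ ((G.suppress D).bad s').encard := by
  classical
  refine ⟨fun a => s' (h.root a), ?_⟩
  set s : α → ZMod 2 := fun a => s' (h.root a) with hs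
  have key : ∀ e, ∃ F, e ∈ G.bad s → e ∉ up '' D ∧ F ∈ (G.suppress D).bad s' ∧ e ∈ F ∧
      F ⊆ insert e (up '' D) := by
    intro e
    by_cases he : e ∈ G.bad s
    · obtain ⟨a, b, hab, hne⟩ := he
      have heD : e ∉ up '' D := by
        rintro ⟨d, hd, rfl⟩
        apply hne
        have h1 : s (parent d) = s d := by simp only [hs, h.root_parent hd]
        rw [sign, if_neg (h.up_notMem d hd)]
        rcases hab.eq_and_eq_or_eq_and_eq (h.link d hd) with ⟨rfl, rfl⟩ | ⟨rfl, rfl⟩ <;>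
        rw [h1, zmod_two_add_self]
      have main : ∀ a b, G.graph.IsLink e a b → s a + s b ≠ G.sign e → a ∉ D →
          ∃ F ∈ (G.suppress D).bad s', e ∈ F ∧ F ⊆ insert e (up '' D) := by
        intro a b hab hne ha
        obtain ⟨F, hF, heF, hFs, -⟩ := h.exists_isThread hab heD ha
        refine ⟨F, ⟨a, h.root b, hF, ?_⟩, heF, hFs⟩
        have h1 : (G.suppress D).sign F = G.sign e := by
          have h3 : F ∩ G.neg = {e} ∩ G.neg := by
            ext f
            constructor
            · rintro ⟨hf, hfn⟩
              rcases hFs hf with rfl | ⟨d, hd, rfl⟩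
              · exact ⟨rfl, hfn⟩
              · exact (h.up_notMem d hd hfn).elim
            · rintro ⟨rfl, hfn⟩
              exact ⟨heF, hfn⟩
          have h2 : F ∈ (G.suppress D).neg ↔ e ∈ G.neg := by
            have h4 : F ∈ (G.suppress D).neg ↔ Odd (F ∩ G.neg).ncard :=
              ⟨fun h => h.2, fun h => ⟨Graph.IsLink.edge_mem (G := G.graph.suppress D) hF, h⟩⟩
            rw [h4, h3]
            by_cases he : e ∈ G.neg
            · rw [inter_eq_self_of_subset_left (by simpa using he)]
              simp [he]
            · have : {e} ∩ G.neg = ∅ := by simpa using he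
              rw [this]
              simp [he]
          by_cases he : e ∈ G.neg
          · rw [sign, sign, if_pos he, if_pos (h2.2 he)]
          · rw [sign, sign, if_neg he, if_neg fun h' => he (h2.1 h')]
        rw [h1]
        simpa only [hs, h.root_of_notMem ha] using hne
      by_cases ha : a ∈ D
      · obtain ⟨F, hF⟩ := main b a hab.symm (by rwa [add_comm]) (h.other e a b hab heD ha).1
        exact ⟨F, fun _ => ⟨heD, hF⟩⟩
      · obtain ⟨F, hF⟩ := main a b hab hne ha
        exact ⟨F, fun _ => ⟨heD, hF⟩⟩
    · exact ⟨∅, fun h' => (he h').elim⟩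
  choose f hf using key
  refine encard_le_encard_of_injOn (f := f) (fun e he => (hf e he).2.1) ?_
  intro e he e' he' hee
  have h1 := (hf e he).2.2.1
  rw [hee] at h1
  rcases (hf e' he').2.2.2 h1 with h2 | h2
  · exact h2
  · exact ((hf e he).1 h2).elim

/-- A violated thread contains a violated edge, and distinct threads are disjoint. The sets `A` and
`B` allow a thread to be deleted together with one of its edges. -/
theorem encard_bad_suppress_sdiff_le (h : G.IsSuppressible D parent up rank) (s : α → ZMod 2)
    (A : Set (Set β)) (B : Set β) (hAB : ∀ F, (∃ x y, G.graph.IsThread D F x y) → F ∉ A →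
      ∀ e ∈ F, e ∉ B) :
    ((G.suppress D).bad s \ A).encard ≤ (G.bad s \ B).encard := by
  classical
  rcases ((G.suppress D).bad s).eq_empty_or_nonempty with hem | ⟨F₀, hF₀⟩
  · simp [hem]
  have : Nonempty β := (G.mem_of_mem_bad_suppress hF₀).2.nonempty
  have key : ∀ F, F ∈ (G.suppress D).bad s → ∃ e, e ∈ F ∧ e ∈ G.bad s :=
    fun F hF => (G.mem_of_mem_bad_suppress hF).2
  choose! f hf using key
  refine encard_le_encard_of_injOn (f := f) (fun F hF => ⟨(hf F hF.1).2, ?_⟩) ?_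
  · exact hAB F (G.mem_of_mem_bad_suppress hF.1).1 hF.2 _ (hf F hF.1).1
  · intro F hF F' hF' hff
    obtain ⟨⟨x, y, h1⟩, -⟩ := G.mem_of_mem_bad_suppress hF.1
    obtain ⟨⟨x', y', h2⟩, -⟩ := G.mem_of_mem_bad_suppress hF'.1
    refine h.thread_eq h1 h2 (hf F hF.1).1 ?_
    rw [hff]
    exact (hf F' hF'.1).1

/-- Membership in `S*` of a graph with suppressed vertices. -/
theorem suppress_mem_sStar (h : G.IsSuppressible D parent up rank) {k : ℕ} (hk : 1 ≤ k)
    {bd : β → α → ZMod 2} (hbd : IsBoundary G.graph bd)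
    (hlower : ∀ s, (k : ℕ∞) ≤ (G.bad s).encard) (hupper : ∃ s, (G.bad s).encard ≤ k)
    (hedge : ∀ e ∈ G.graph.edgeSet, ∃ s, e ∈ G.bad s ∧ (G.bad s).encard ≤ k)
    (hcirc : ∀ Z U : Finset β, (Z : Set β) ⊆ G.graph.edgeSet → (U : Set β) ⊆ G.graph.edgeSet →
      (∀ z, ∑ b ∈ Z, bd b z = 0) → (∀ z, ∑ b ∈ U, bd b z = 0) → ∑ b ∈ Z, G.sign b = 1 →
      ∑ b ∈ U, G.sign b = 1 → ¬ Disjoint Z U) :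
    G.suppress D ∈ SStar k := by
  apply mem_sStar_of_isCritical
  · refine isCritical_of_bad _ hk (fun s' => ?_) ?_ ?_
    · obtain ⟨s, hs⟩ := h.exists_encard_le s'
      exact (hlower s).trans hs
    · obtain ⟨s, hs⟩ := hupper
      refine ⟨s, le_trans ?_ hs⟩
      simpa using h.encard_bad_suppress_sdiff_le s ∅ ∅ (by simp)
    · intro F hF
      obtain ⟨x, y, hxy⟩ := Graph.exists_isLink_of_mem_edgeSet hF
      have hthr : G.graph.IsThread D F x y := hxy
      -- Any edge of the thread would do: deleting the thread saves one violated edge in a colouring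
      -- that violates `e`.
      obtain ⟨e, he, -⟩ := h.exists_notMem_of_isThread hthr
      obtain ⟨s, hes, hs⟩ := hedge e (subset_edgeSet_of_isThread hthr he)
      refine ⟨s, (h.encard_bad_suppress_sdiff_le s {F} {e} ?_).trans_lt ?_⟩
      · rintro F' ⟨x', y', hF'⟩ hne f hf rfl
        exact hne (h.thread_eq hF' hthr hf he)
      · have h1 := encard_sdiff_singleton_add_one hes
        rw [← h1] at hs
        exact (ENat.add_one_le_iff (fun hc => by simp [hc] at hs)).1 hs
  · intro C C' hC hC' hneg hneg' hdisj
    obtain ⟨Z, hZ, hZ0, hZ1, hZC⟩ := h.exists_finset_of_isCircuit hbd hC hneg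
    obtain ⟨U, hU, hU0, hU1, hUC⟩ := h.exists_finset_of_isCircuit hbd hC' hneg'
    apply hcirc Z U hZ hU hZ0 hU0 hZ1 hU1
    rw [Finset.disjoint_left]
    intro b hb hb'
    obtain ⟨F, hF, hbF⟩ := hZC b hb
    obtain ⟨F', hF', hbF'⟩ := hUC b hb'
    obtain ⟨x, y, hxy⟩ := Graph.exists_isLink_of_mem_edgeSet (IsCircuit.subset_edgeSet hC hF)
    obtain ⟨x', y', hxy'⟩ := Graph.exists_isLink_of_mem_edgeSet (IsCircuit.subset_edgeSet hC' hF')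
    have := h.thread_eq hxy hxy' hbF hbF'
    subst this
    exact disjoint_left.1 hdisj hF hF'

/-- Follow forest edges away from the root: ranks increase and are bounded, so eventually the second
edge at the current vertex is outside the forest. -/
theorem exists_chain (h : G.IsSuppressible D parent up rank) {d : α} (hd : d ∈ D) :
    ∃ e a b i, G.graph.IsLink e a b ∧ e ∉ up '' D ∧ a ∉ D ∧ i < h.depth b ∧ parent^[i] b = d := by
  obtain ⟨B, hB⟩ := h.rank_bound
  induction hm : B - rank d using Nat.strong_induction_on generalizing d with
  | _ m ih =>
  obtain ⟨o, hne, ⟨b, hob⟩, -⟩ := h.inc d hd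
  by_cases ho : o ∈ up '' D
  · obtain ⟨d', hd', rfl⟩ := ho
    have h1 : parent d' = d := by
      rcases hob.eq_and_eq_or_eq_and_eq (h.link d' hd') with ⟨rfl, -⟩ | ⟨rfl, -⟩
      · exact (hne rfl).elim
      · rfl
    have h2 := h.rank_parent d' hd'
    rw [h1] at h2
    have h3 := hB d' hd'
    obtain ⟨e, a, b, i, hl, he, ha, hi, hid⟩ := ih (B - rank d') (by omega) hd' rfl
    refine ⟨e, a, b, i + 1, hl, he, ha, ?_, by rw [Function.iterate_succ_apply', hid, h1]⟩
    by_contra hcon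
    have h4 : h.depth b = i + 1 := by omega
    have h5 := h.root_notMem b
    rw [root, h4, Function.iterate_succ_apply', hid, h1] at h5
    exact h5 hd
  · refine ⟨o, b, d, 0, hob.symm, ho, (h.other o d b hob ho hd).1, ?_, rfl⟩
    rw [h.depth_of_mem hd]
    omega

theorem exists_thread_of_mem (h : G.IsSuppressible D parent up rank) {e : β}
    (he : e ∈ G.graph.edgeSet) : ∃ F, e ∈ F ∧ ∃ x y, G.graph.IsThread D F x y := by
  by_cases heD : e ∈ up '' D
  · obtain ⟨d, hd, rfl⟩ := heD
    obtain ⟨f, a, b, i, hl, hf, ha, hi, rfl⟩ := h.exists_chain hd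
    obtain ⟨F, hF, -, -, hFu⟩ := h.exists_isThread hl hf ha
    exact ⟨F, hFu i hi, _, _, hF⟩
  · obtain ⟨a, b, hab, ha⟩ := h.exists_link_of_notMem he heD
    obtain ⟨F, hF, heF, -⟩ := h.exists_isThread hab heD ha
    exact ⟨F, heF, _, _, hF⟩

/-- Suppression does not change the degrees of the remaining vertices. -/
theorem degree_suppress (h : G.IsSuppressible D parent up rank) {a : α} (ha : a ∉ D) :
    (G.graph.suppress D).degree a = (G.graph.incidenceSet a).encard := by
  have hloop : (G.graph.suppress D).loopSet a = ∅ := by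
    rw [eq_empty_iff_forall_notMem]
    intro F hF
    exact h.ends_ne (show G.graph.IsThread D F a a from hF) rfl
  rw [Graph.degree, hloop, encard_empty, add_zero]
  have hinc : ∀ F, F ∈ (G.graph.suppress D).incidenceSet a → ∃ y, G.graph.IsThread D F a y :=
    fun F hF => hF
  -- Since the ends of a thread differ, exactly one of its edges meets `a`; this matches threads at
  -- `a` with edges at `a`.
  have hfirst : ∀ F y, G.graph.IsThread D F a y →
      ∃ e ∈ F, G.graph.Inc e a ∧ ∀ f ∈ F, G.graph.Inc f a → f = e := by
    intro F y hF
    have hne := h.ends_ne hF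
    obtain ⟨hx, hy, n, v, e, hn, h0, hn', hD, hv, he, hl, rfl⟩ := hF
    refine ⟨e 0, ⟨0, hn, rfl⟩, h0 ▸ (hl 0 hn).inc_left, ?_⟩
    rintro _ ⟨j, hj, rfl⟩ hja
    simp only [mem_Iio] at hj
    have key : ∀ m ≤ n, a = v m → m = 0 := by
      intro m hm hma
      by_contra hm0
      rcases hm.eq_or_lt with rfl | hlt
      · exact hne (hma.trans hn')
      · exact ha (hma ▸ hD m ⟨by omega, hlt⟩)
    rcases hja.eq_or_eq_of_isLink (hl j hj) with h1 | h1
    · rw [key j hj.le h1]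
    · have := key (j + 1) hj h1
      omega
  apply le_antisymm
  · rcases ((G.graph.suppress D).incidenceSet a).eq_empty_or_nonempty with hem | ⟨F₀, hF₀⟩
    · simp [hem]
    have : Nonempty β := by
      obtain ⟨y, hy⟩ := hinc F₀ hF₀
      obtain ⟨e, -⟩ := hfirst F₀ y hy
      exact ⟨e⟩
    have key : ∀ F, F ∈ (G.graph.suppress D).incidenceSet a → ∃ e ∈ F, G.graph.Inc e a := by
      intro F hF
      obtain ⟨y, hy⟩ := hinc F hF
      obtain ⟨e, he, hea, -⟩ := hfirst F y hy
      exact ⟨e, he, hea⟩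
    choose! f hf using key
    refine encard_le_encard_of_injOn (f := f) (fun F hF => (hf F hF).2) ?_
    intro F hF F' hF' hff
    obtain ⟨y, hy⟩ := hinc F hF
    obtain ⟨y', hy'⟩ := hinc F' hF'
    exact h.thread_eq hy hy' (hf F hF).1 (hff ▸ (hf F' hF').1)
  · have key : ∀ e, e ∈ G.graph.incidenceSet a → ∃ F, e ∈ F ∧ ∃ y, G.graph.IsThread D F a y := by
      intro e he
      have hea : G.graph.Inc e a := he
      obtain ⟨F, heF, x, y, hF⟩ := h.exists_thread_of_mem hea.edge_mem
      refine ⟨F, heF, ?_⟩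
      obtain ⟨hx, hy, n, v, f, hn, h0, hn', hD, hv, hf, hl, hFe⟩ := id hF
      have key : ∀ m ≤ n, a = v m → a = x ∨ a = y := by
        intro m hm hma
        rcases Nat.eq_zero_or_pos m with rfl | hm0
        · exact Or.inl (hma.trans h0)
        · rcases hm.eq_or_lt with rfl | hlt
          · exact Or.inr (hma.trans hn')
          · exact (ha (hma ▸ hD m ⟨hm0, hlt⟩)).elim
      have h1 : a = x ∨ a = y := by
        rw [hFe] at heF
        obtain ⟨j, hj, rfl⟩ := heF
        rcases hea.eq_or_eq_of_isLink (hl j hj) with h1 | h1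
        · exact key j (le_of_lt hj) h1
        · exact key (j + 1) hj h1
      rcases h1 with rfl | rfl
      · exact ⟨y, hF⟩
      · exact ⟨x, hF.symm⟩
    choose! f hf using key
    refine encard_le_encard_of_injOn (f := f) (fun e he => (hf e he).2) ?_
    intro e he e' he' hee
    obtain ⟨y, hy⟩ := (hf e he).2
    obtain ⟨g, -, -, hg⟩ := hfirst _ y hy
    rw [hg e (hf e he).1 he, hg e' (hee ▸ (hf e' he').1) he']

end IsSuppressible

end SignedGraph

/-! ### Coordinates of the wall and its violated edges -/

namespace Wall

/-- `o` is the parity of `k` and `T = ⌈k / 2⌉`. -/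
structure Params (k T o : ℕ) : Prop where
  eq : k + o = 2 * T
  le_one : o ≤ 1
  two_le : 2 ≤ T

theorem exists_params {k : ℕ} (hk : 3 ≤ k) : ∃ T o, Params k T o :=
  ⟨(k + 1) / 2, k % 2, by omega, by omega, by omega⟩

/-- The horizontal edge from `(p, c)` to `(p, c + 1)` is in the wall. -/
def IsHor (T o p c : ℕ) : Prop :=
  1 ≤ p ∧ p ≤ 2 * T ∧ T ≤ p + c ∧ p ≤ c + T + 1 ∧ c + 2 + 2 * o < 3 * T + p ∧
    c + 1 + 2 * o + p < 5 * T

/-- The vertical edge from `(r, c)` to `(r + 1, c)` is in the wall. -/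
def IsVer (T o r c : ℕ) : Prop :=
  1 ≤ r ∧ r < 2 * T ∧ T ≤ c + r ∧ r ≤ c + T ∧ (c + r + T) % 2 = 0 ∧ c + 2 + 2 * o ≤ 3 * T + r ∧
    c + 2 + 2 * o + r ≤ 5 * T ∧
    -- The first alternative says that the edge is among the first `keep` ones of its row, the
    -- second that it is among the last ones. Each pair of inequalities handles both the upper and
    -- the lower half.
    ((c + 2 * o < T + 3 * r ∧ c + 2 * o + 3 * r < 7 * T) ∨ (3 * T ≤ c + 3 * r ∧ 3 * r ≤ c + 3 * T))

variable {k T o : ℕ}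

/-- The column of a vertical edge. -/
def col (k r j : ℕ) : ℕ := startCol k (rowIndex k r) + 2 * j

namespace Params

theorem mid_eq (h : Params k T o) : mid k = T := by
  have := h.eq; have := h.le_one; unfold mid; omega

theorem keep_eq (h : Params k T o) (i : ℕ) : keep k i = 2 * i - o := by
  have := h.eq; have := h.le_one
  unfold keep
  split_ifs with hk <;> rw [Nat.even_iff] at hk <;> omega

theorem rowLength_eq (h : Params k T o) (i : ℕ) : rowLength k i = T - o + i - 1 := by
  have := h.eq; have := h.le_one; unfold rowLength; omega

theorem startCol_eq (h : Params k T o) (i : ℕ) : startCol k i = T - i := by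
  unfold startCol; rw [h.mid_eq]

theorem isEdge_horizontal (h : Params k T o) (p c : ℕ) :
    IsEdge k (.horizontal p c) ↔ IsHor T o p c := by
  have h1 := h.eq; have h2 := h.le_one; have h3 := h.two_le
  simp only [IsEdge, IsHor, mem_Icc, mem_Ico, endCol, h.startCol_eq, h.rowLength_eq, pathIndex,
    numPaths, h.mid_eq]
  omega

theorem col_eq (h : Params k T o) (r j : ℕ) : col k r j = T - min r (2 * T - r) + 2 * j := by
  rw [col, h.startCol_eq, rowIndex, h.mid_eq]

theorem isEdge_vertical (h : Params k T o) (r j : ℕ) :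
    IsEdge k (.vertical r j) ↔ IsVer T o r (col k r j) := by
  have h1 := h.eq; have h2 := h.le_one; have h3 := h.two_le
  simp only [IsEdge, IsVer, mem_Ico, h.rowLength_eq, rowIndex,
    numPaths, h.mid_eq, h.keep_eq, h.col_eq]
  omega

theorem exists_vertical (h : Params k T o) {r c : ℕ} (hc : IsVer T o r c) :
    ∃ j, IsEdge k (.vertical r j) ∧ col k r j = c := by
  refine ⟨(c - (T - min r (2 * T - r))) / 2, ?_⟩
  have h1 : col k r ((c - (T - min r (2 * T - r))) / 2) = c := by
    rw [h.col_eq]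
    unfold IsVer at hc
    omega
  rw [h.isEdge_vertical, h1]
  exact ⟨hc, rfl⟩

theorem x_eq (h : Params k T o) (i : ℕ) : x k i = (i, T - min i (2 * T + 1 - i)) := by
  rw [x, h.startCol_eq, pathIndex, h.mid_eq]

theorem y_eq (h : Params k T o) (i : ℕ) : y k i = (2 * T + 1 - i,
    T - min (2 * T + 1 - i) (2 * T + 1 - (2 * T + 1 - i)) +
      2 * (T - o + min (2 * T + 1 - i) (2 * T + 1 - (2 * T + 1 - i)) - 1)) := by
  rw [y, endCol, h.startCol_eq, h.rowLength_eq, pathIndex, numPaths, h.mid_eq]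

theorem x_upper (h : Params k T o) {i : ℕ} (hi : i ≤ T) : x k i = (i, T - i) := by
  rw [h.x_eq]; congr 1; omega

theorem x_lower (h : Params k T o) {i : ℕ} (hi : T < i) (hi' : i ≤ 2 * T) :
    x k i = (i, i - T - 1) := by
  rw [h.x_eq]; congr 1; omega

theorem y_upper (h : Params k T o) {i : ℕ} (h0 : 1 ≤ i) (hi : i ≤ T) :
    y k i = (2 * T + 1 - i, 3 * T + i - 2 - 2 * o) := by
  have := h.le_one; have := h.two_le
  rw [h.y_eq]; congr 1; omega

theorem y_lower (h : Params k T o) {i : ℕ} (hi : T < i) (hi' : i ≤ 2 * T) :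
    y k i = (2 * T + 1 - i, 5 * T - 1 - i - 2 * o) := by
  have := h.le_one; have := h.two_le
  rw [h.y_eq]; congr 1; omega

theorem isEdge_chord (h : Params k T o) (i : ℕ) :
    IsEdge k (.chord i) ↔ 1 ≤ i ∧ i + o ≤ 2 * T := by
  have := h.eq
  simp only [IsEdge, mem_Icc]; omega

end Params

theorem edgeSet_eq : (signedWall k).graph.edgeSet = {e | IsEdge k e} := by
  ext e
  rw [Graph.edge_mem_iff_exists_isLink]
  exact ⟨fun ⟨_, _, h⟩ => h.1, fun h => ⟨_, _, h, Or.inl rfl⟩⟩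

theorem isLink_ends {e : Edge} (he : IsEdge k e) :
    (signedWall k).graph.IsLink e (ends k e).1 (ends k e).2 := ⟨he, Or.inl rfl⟩

theorem mem_bad_iff {s : ℕ × ℕ → ZMod 2} {e : Edge} : e ∈ (signedWall k).bad s ↔
    IsEdge k e ∧ s (ends k e).1 + s (ends k e).2 ≠ (signedWall k).sign e := by
  constructor
  · rintro ⟨a, b, ⟨he, h | h⟩, hne⟩
    · rw [h]; exact ⟨he, hne⟩
    · rw [h, add_comm]; exact ⟨he, hne⟩
  · rintro ⟨he, hne⟩
    exact ⟨_, _, isLink_ends he, hne⟩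

theorem sign_chord {i : ℕ} (hi : IsEdge k (.chord i)) : (signedWall k).sign (.chord i) = 1 :=
  if_pos ⟨i, hi, rfl⟩

theorem sign_horizontal (p c : ℕ) : (signedWall k).sign (.horizontal p c) = 0 :=
  if_neg (by rintro ⟨i, -, h⟩; cases h)

theorem sign_vertical (r j : ℕ) : (signedWall k).sign (.vertical r j) = 0 :=
  if_neg (by rintro ⟨i, -, h⟩; cases h)

theorem add_ne_zero_iff {a b : ZMod 2} : a + b ≠ 0 ↔ a ≠ b := by
  revert a b; decide

theorem add_ne_one_iff {a b : ZMod 2} : a + b ≠ 1 ↔ a = b := by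
  revert a b; decide

variable {s : ℕ × ℕ → ZMod 2}

theorem horizontal_mem_bad (h : Params k T o) {p c : ℕ} :
    Edge.horizontal p c ∈ (signedWall k).bad s ↔ IsHor T o p c ∧ s (p, c) ≠ s (p, c + 1) := by
  rw [mem_bad_iff, sign_horizontal, add_ne_zero_iff, h.isEdge_horizontal]; rfl

theorem vertical_mem_bad (h : Params k T o) {r j : ℕ} :
    Edge.vertical r j ∈ (signedWall k).bad s ↔
      IsVer T o r (col k r j) ∧ s (r, col k r j) ≠ s (r + 1, col k r j) := by
  rw [mem_bad_iff, sign_vertical, add_ne_zero_iff, h.isEdge_vertical]; rfl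

theorem chord_mem_bad {i : ℕ} :
    Edge.chord i ∈ (signedWall k).bad s ↔ i ∈ Icc 1 k ∧ s (x k i) = s (y k i) := by
  rw [mem_bad_iff]
  constructor
  · rintro ⟨h, h'⟩
    rw [sign_chord h, add_ne_one_iff] at h'
    exact ⟨h, h'⟩
  · rintro ⟨h, h'⟩
    refine ⟨h, ?_⟩
    rw [sign_chord h, add_ne_one_iff]
    exact h'

end Wall

/-! ### Half-turn symmetry and the distribution of edge copies to walks -/

namespace Wall

variable {k T o : ℕ}

/-- Replace the number of a vertical edge by its column. -/
def toCol (k : ℕ) : Edge → Edge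
  | .vertical r j => .vertical r (col k r j)
  | e => e

/-- The edges that violate the colouring `s`, with vertical edges named by their columns. -/
def colBad (k T o : ℕ) (s : ℕ × ℕ → ZMod 2) : Edge → Prop
  | .horizontal p c => IsHor T o p c ∧ s (p, c) ≠ s (p, c + 1)
  | .vertical r c => IsVer T o r c ∧ s (r, c) ≠ s (r + 1, c)
  | .chord i => (1 ≤ i ∧ i + o ≤ 2 * T) ∧ s (x k i) = s (y k i)

theorem toCol_injective : Function.Injective (toCol k) := by
  rintro (_ | _ | _) (_ | _ | _) h <;> simp only [toCol, col] at h <;> grind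

theorem Params.toCol_image_bad (h : Params k T o) (s : ℕ × ℕ → ZMod 2) :
    toCol k '' (signedWall k).bad s = {e | colBad k T o s e} := by
  ext e
  constructor
  · rintro ⟨e, he, rfl⟩
    rcases e with ⟨p, c⟩ | ⟨r, j⟩ | i
    · exact (horizontal_mem_bad h).1 he
    · exact (vertical_mem_bad h).1 he
    · have := chord_mem_bad.1 he
      exact ⟨(h.isEdge_chord i).1 this.1, this.2⟩
  · intro he
    rcases e with ⟨p, c⟩ | ⟨r, c⟩ | i
    · exact ⟨_, (horizontal_mem_bad h).2 he, rfl⟩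
    · obtain ⟨j, hj, rfl⟩ := h.exists_vertical he.1
      exact ⟨.vertical r j, (vertical_mem_bad h).2 he, rfl⟩
    · exact ⟨.chord i, chord_mem_bad.2 ⟨(h.isEdge_chord i).2 he.1, he.2⟩, rfl⟩

theorem Params.encard_bad (h : Params k T o) (s : ℕ × ℕ → ZMod 2) :
    ((signedWall k).bad s).encard = {e | colBad k T o s e}.encard := by
  rw [← h.toCol_image_bad, toCol_injective.encard_image]

/-- Rotation of the grid by a half-turn. -/
def rot (T o : ℕ) (a : ℕ × ℕ) : ℕ × ℕ := (2 * T + 1 - a.1, 4 * T - 2 - 2 * o - a.2)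

/-- Rotation of edges by a half-turn, with vertical edges named by their columns. -/
def rotEdge (T o : ℕ) : Edge → Edge
  | .horizontal p c => .horizontal (2 * T + 1 - p) (4 * T - 3 - 2 * o - c)
  | .vertical r c => .vertical (2 * T - r) (4 * T - 2 - 2 * o - c)
  | .chord i => .chord i

/-- The edges of the wall, with vertical edges named by their columns. -/
def IsColEdge (T o : ℕ) : Edge → Prop
  | .horizontal p c => IsHor T o p c
  | .vertical r c => IsVer T o r c
  | .chord i => 1 ≤ i ∧ i + o ≤ 2 * T

theorem colBad.isColEdge {s : ℕ × ℕ → ZMod 2} {e : Edge} (he : colBad k T o s e) :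
    IsColEdge T o e := by
  rcases e with _ | _ | _ <;> exact he.1

namespace Params

theorem isColEdge_rotEdge (h : Params k T o) {e : Edge} (he : IsColEdge T o e) :
    IsColEdge T o (rotEdge T o e) := by
  have h1 := h.eq; have h2 := h.le_one; have h3 := h.two_le
  rcases e with ⟨p, c⟩ | ⟨r, c⟩ | i <;> simp only [IsColEdge, rotEdge, IsHor, IsVer] at he ⊢ <;>
    omega

theorem rotEdge_rotEdge (h : Params k T o) {e : Edge} (he : IsColEdge T o e) :
    rotEdge T o (rotEdge T o e) = e := by
  have h1 := h.eq; have h2 := h.le_one; have h3 := h.two_le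
  rcases e with ⟨p, c⟩ | ⟨r, c⟩ | i <;>
    simp only [IsColEdge, rotEdge, IsHor, IsVer] at he ⊢
  · congr 1 <;> omega
  · congr 1 <;> omega

theorem rot_x (h : Params k T o) {i : ℕ} (h0 : 1 ≤ i) (hi : i ≤ 2 * T) :
    rot T o (x k i) = y k i := by
  have h1 := h.eq; have h2 := h.le_one; have h3 := h.two_le
  rcases le_or_gt i T with h4 | h4
  · rw [h.x_upper h4, h.y_upper h0 h4]; simp only [rot, Prod.mk.injEq]; exact ⟨trivial, by omega⟩
  · rw [h.x_lower h4 hi, h.y_lower h4 hi]; simp only [rot, Prod.mk.injEq]; exact ⟨trivial, by omega⟩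

theorem rot_y (h : Params k T o) {i : ℕ} (h0 : 1 ≤ i) (hi : i ≤ 2 * T) :
    rot T o (y k i) = x k i := by
  have h1 := h.eq; have h2 := h.le_one; have h3 := h.two_le
  rcases le_or_gt i T with h4 | h4
  · rw [h.x_upper h4, h.y_upper h0 h4]; simp only [rot, Prod.mk.injEq]
    exact ⟨by omega, by omega⟩
  · rw [h.x_lower h4 hi, h.y_lower h4 hi]; simp only [rot, Prod.mk.injEq]
    exact ⟨by omega, by omega⟩

theorem colBad_rotEdge_iff (h : Params k T o) {s : ℕ × ℕ → ZMod 2} {e : Edge}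
    (he : IsColEdge T o e) : colBad k T o (s ∘ rot T o) e ↔ colBad k T o s (rotEdge T o e) := by
  have h0 := h.isColEdge_rotEdge he
  have h1 := h.eq; have h2 := h.le_one; have h3 := h.two_le
  rcases e with ⟨p, c⟩ | ⟨r, c⟩ | i
  · refine and_congr (iff_of_true he h0) ?_
    simp only [IsColEdge, IsHor] at he
    simp only [Function.comp, rot]
    rw [show 4 * T - 3 - 2 * o - c + 1 = 4 * T - 2 - 2 * o - c by omega,
      show 4 * T - 2 - 2 * o - (c + 1) = 4 * T - 3 - 2 * o - c by omega]
    exact ne_comm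
  · refine and_congr (iff_of_true he h0) ?_
    simp only [IsColEdge, IsVer] at he
    simp only [Function.comp, rot]
    rw [show 2 * T - r + 1 = 2 * T + 1 - r by omega,
      show 2 * T + 1 - (r + 1) = 2 * T - r by omega]
    exact ne_comm
  · refine and_congr Iff.rfl ?_
    simp only [IsColEdge] at he
    simp only [Function.comp]
    rw [h.rot_x he.1 (by omega), h.rot_y he.1 (by omega)]
    exact eq_comm

end Params

/-- The south-west stair through the vertical edge in row `r` and column `c` belongs to the walk
that is closed by chord `i`. -/
def OwnsSW (T o r r' c i : ℕ) : Prop :=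
  -- A stair alternates vertical edges with the horizontal edges just below them. The pair `(r, c)`
  -- names the vertical edge of the step, while `r'` is the row or path of the edge in question; it
  -- serves only to cut the stairs of walk 1 in the middle.
  (c + r + T + 2 = 2 * i ∧ 2 * T + 1 ≤ r + i ∧ i + o ≤ 2 * T ∧ T < i) ∨
    (c + r + 2 * i = 3 * T ∧ r < i ∧ i ≤ T) ∨ (o = 1 ∧ i = 1 ∧ c + r + 2 = 3 * T ∧ r' ≤ T)

/-- The south-east stair through the vertical edge in row `r` and column `c` belongs to the walk
that is closed by chord `i`; the upper part of the stair in column `c = r + T - 2` is not used. -/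
def OwnsSE (T o r r' c i : ℕ) : Prop :=
  (c + 2 + 2 * o = r + T + 2 * i ∧ 1 + o ≤ i ∧ i ≤ T) ∨
    (o = 1 ∧ i = 1 ∧ c + 2 = r + T ∧ T + 1 ≤ r')

/-- Two copies of each edge are distributed to closed walks. One walk with chord `i` uses the copies
for which this relation holds, another one those obtained by a half-turn. -/
def Owns (T o : ℕ) : Edge → Bool → ℕ → Prop
  -- For odd `k`, all of path 1 goes to walk 1. Otherwise the right part of path `p` goes to walk
  -- `2T + 1 - p`, its beginning to walk `p`, and any stretch in between to the top of the detour of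
  -- walk `T + 1 + o - 2p`.
  | .horizontal p c, false, i => p ≤ T ∧ ((o = 1 ∧ p = 1 ∧ i = 1) ∨ (¬ (o = 1 ∧ p = 1) ∧
      ((3 * T ≤ c + 3 * p ∧ i + p = 2 * T + 1) ∨
        (c + 3 * p < 3 * T ∧ c + 2 + 2 * o < T + 3 * p ∧ i = p) ∨
        (c + 3 * p < 3 * T ∧ T + 3 * p ≤ c + 2 + 2 * o ∧ i = T + 1 + o - 2 * p))))
  | .horizontal p c, true, i =>
      ((p ≤ T ∧ T + 3 * p ≤ c + 4 + 2 * o ∧ c + 3 * p < 3 * T + 2) ∧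
        -- The minimum matters only for `o = 1`, `p = 1`: there walk `T` takes the second copy
        -- because walk 1 has the first.
        i = min T (T + 2 + o - 2 * p)) ∨
      (¬ (p ≤ T ∧ T + 3 * p ≤ c + 4 + 2 * o ∧ c + 3 * p < 3 * T + 2) ∧
        (OwnsSW T o (p - 1) p (c + 1) i ∨ OwnsSE T o (p - 1) p c i))
  | .vertical r c, false, i => OwnsSW T o r r c i
  | .vertical r c, true, i => OwnsSE T o r r c i
  | .chord j, false, i => i = j
  | .chord _, true, _ => False

/-- The half-turn of copies of edges. -/
def rotCopy (T o : ℕ) : Edge → Bool → Bool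
  | .horizontal _ _, b => b
  -- The central vertical edge, which exists only for odd `k`, is fixed by the half-turn, so its two
  -- copies must be swapped.
  | .vertical r c, b => if r = T ∧ c + 1 + o = 2 * T then !b else b
  | .chord _, b => !b

namespace Params

theorem owns_unique (h : Params k T o) {e : Edge} {b : Bool} (he : IsColEdge T o e) {i i' : ℕ}
    (hi : Owns T o e b i) (hi' : Owns T o e b i') : i = i' := by
  have h1 := h.eq; have h2 := h.le_one; have h3 := h.two_le
  rcases e with ⟨p, c⟩ | ⟨r, c⟩ | j <;> rcases b with _ | _ <;>
    simp only [IsColEdge, IsHor, IsVer, Owns, OwnsSW, OwnsSE] at he hi hi' <;> omega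

theorem not_owns_rotCopy (h : Params k T o) {e : Edge} {b : Bool} (he : IsColEdge T o e)
    {i i' : ℕ} (hi : Owns T o e b i) : ¬ Owns T o (rotEdge T o e) (rotCopy T o e b) i' := by
  have h1 := h.eq; have h2 := h.le_one; have h3 := h.two_le
  rcases e with ⟨p, c⟩ | ⟨r, c⟩ | j
  · rcases b with _ | _ <;>
    simp only [IsColEdge, IsHor, rotEdge, rotCopy, Owns, OwnsSW, OwnsSE] at he hi ⊢ <;> omega
  · simp only [rotCopy]
    split_ifs with h4 <;> rcases b with _ | _ <;>
    simp only [IsColEdge, IsVer, rotEdge, Bool.not_false, Bool.not_true,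
      Owns, OwnsSW, OwnsSE] at he hi ⊢ <;> omega
  · rcases b with _ | _ <;> simp [rotEdge, rotCopy, Owns] at hi ⊢

end Params

end Wall

/-! ### Lower bound: every colouring violates each walk -/

namespace Wall

variable {k T o : ℕ} {s : ℕ × ℕ → ZMod 2}

theorem eq_of_horizontal {p c c' : ℕ} (hc : c ≤ c')
    (h : ∀ j, c ≤ j → j < c' → s (p, j) = s (p, j + 1)) : s (p, c) = s (p, c') := by
  induction c', hc using Nat.le_induction with
  | base => rfl
  | succ n hn ih => rw [ih fun j h1 h2 => h j h1 (by omega), h n hn (by omega)]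

theorem eq_of_southWest {d r r' : ℕ} (hr : r ≤ r') (hd : r' ≤ d)
    (hv : ∀ j, r ≤ j → j < r' → s (j, d - j) = s (j + 1, d - j))
    (hh : ∀ j, r < j → j ≤ r' → s (j, d - j) = s (j, d - j + 1)) :
    s (r, d - r) = s (r', d - r') := by
  induction r', hr using Nat.le_induction with
  | base => rfl
  | succ n hn ih =>
    rw [ih (by omega) (fun j h1 h2 => hv j h1 (by omega)) (fun j h1 h2 => hh j h1 (by omega)),
      hv n hn (by omega), hh (n + 1) (by omega) le_rfl]
    congr 2; omega

theorem eq_of_southEast {d r r' : ℕ} (hr : r ≤ r')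
    (hv : ∀ j, r ≤ j → j < r' → s (j, d + j) = s (j + 1, d + j))
    (hh : ∀ j, r < j → j ≤ r' → s (j, d + j - 1) = s (j, d + j - 1 + 1)) :
    s (r, d + r) = s (r', d + r') := by
  induction r', hr using Nat.le_induction with
  | base => rfl
  | succ n hn ih =>
    rw [ih (fun j h1 h2 => hv j h1 (by omega)) (fun j h1 h2 => hh j h1 (by omega)),
      hv n hn (by omega)]
    exact hh (n + 1) (by omega) le_rfl

/-- The colouring is constant on the edges of the wall that have a copy in walk `i`. -/
def IsConstOn (T o : ℕ) (s : ℕ × ℕ → ZMod 2) (i : ℕ) : Prop :=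
  (∀ p c b, IsHor T o p c → Owns T o (.horizontal p c) b i → s (p, c) = s (p, c + 1)) ∧
    ∀ r c b, IsVer T o r c → Owns T o (.vertical r c) b i → s (r, c) = s (r + 1, c)

namespace Params

/-- The walk climbs from `x` to path `p` on a stair, reaching it in column `3T - 3p`, and follows
path `p` to its right end, which is `y`. -/
theorem eq_of_isConstOn_lower (h : Params k T o) {p : ℕ} (hp : 1 + o ≤ p) (hpT : p ≤ T)
    (hs : IsConstOn T o s (2 * T + 1 - p)) :
    s (x k (2 * T + 1 - p)) = s (y k (2 * T + 1 - p)) := by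
  have h1 := h.eq; have h2 := h.le_one; have h3 := h.two_le
  obtain ⟨hh, hv⟩ := hs
  rw [h.x_lower (by omega) (by omega), h.y_lower (by omega) (by omega)]
  have e1 : s (p, 3 * T - 3 * p) = s (p, 3 * T + p - 2 - 2 * o) := by
    refine eq_of_horizontal (by omega) fun c hc hc' => hh p c false ?_ ?_
    · unfold IsHor; omega
    · simp only [Owns]; omega
  have e2 : s (p, 3 * T - 2 * p - p) = s (2 * T - p, 3 * T - 2 * p - (2 * T - p)) := by
    refine eq_of_southWest (by omega) (by omega) (fun r hr hr' => hv _ _ false ?_ ?_)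
      (fun r hr hr' => hh _ _ true ?_ ?_)
    · unfold IsVer; omega
    · simp only [Owns, OwnsSW]; omega
    · unfold IsHor; omega
    · simp only [Owns, OwnsSW]; omega
  have e3 := hv (2 * T - p) (T - p) false (by unfold IsVer; omega)
    (by simp only [Owns, OwnsSW]; omega)
  rw [show 3 * T - 2 * p - p = 3 * T - 3 * p by omega, e1,
    show 3 * T - 2 * p - (2 * T - p) = T - p by omega, e3] at e2
  rw [show 2 * T + 1 - (2 * T + 1 - p) = p by omega,
    show 5 * T - 1 - (2 * T + 1 - p) - 2 * o = 3 * T + p - 2 - 2 * o by omega, e2]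
  congr 2 <;> omega

/-- The middle of path `p` serves other walks, so walk `p` climbs a stair to a higher path `q`,
follows it, and descends on a stair back to path `p`. -/
theorem eq_of_isConstOn_detour (h : Params k T o) {p : ℕ} (hp : 1 + o ≤ p) (hpT : p ≤ T)
    (h4 : 3 * T - 3 * p < T + 3 * p - 2 - 2 * o) (hs : IsConstOn T o s p) :
    s (p, 3 * T - 2 * p - p) = s (p, T + 2 * p - 2 - 2 * o + p) := by
  have h1 := h.eq; have h2 := h.le_one; have h3 := h.two_le
  obtain ⟨hh, hv⟩ := hs
  -- So `p + 2q` is `T + 2 + o` or `T + 1 + o`: two walks may share level `q`, and the parity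
  -- decides which copy each takes.
  obtain ⟨q, hq⟩ : ∃ q, q = (T + 2 + o - p) / 2 := ⟨_, rfl⟩
  have f1 : s (q, 3 * T - 2 * p - q) = s (p, 3 * T - 2 * p - p) := by
    refine eq_of_southWest (by omega) (by omega) (fun r hr hr' => hv _ _ false ?_ ?_)
      (fun r hr hr' => hh _ _ true ?_ ?_)
    · unfold IsVer; omega
    · simp only [Owns, OwnsSW]; omega
    · unfold IsHor; omega
    · simp only [Owns, OwnsSE, OwnsSW]; omega
  have f2 : s (q, T + 2 * p - 2 - 2 * o + q) = s (p, T + 2 * p - 2 - 2 * o + p) := by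
    refine eq_of_southEast (by omega) (fun r hr hr' => hv _ _ true ?_ ?_)
      (fun r hr hr' => hh _ _ true ?_ ?_)
    · unfold IsVer; omega
    · simp only [Owns, OwnsSE]; omega
    · unfold IsHor; omega
    · simp only [Owns, OwnsSE, OwnsSW]; omega
  have f3 : s (q, 3 * T - 2 * p - q) = s (q, T + 2 * p - 2 - 2 * o + q) := by
    by_cases h5 : 2 * p + 4 * q = 2 * T + 2 + 2 * o ∧ ¬ (o = 1 ∧ q = 1)
    · refine eq_of_horizontal (by omega) fun c hc hc' => hh q c false ?_ ?_
      · unfold IsHor; omega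
      · simp only [Owns]; omega
    · refine eq_of_horizontal (by omega) fun c hc hc' => hh q c true ?_ ?_
      · unfold IsHor; omega
      · simp only [Owns]; left; omega
  rw [← f1, f3, f2]

/-- Walk `p` follows path `p` from `x` and descends to `y` on the stair that leaves path `p` in
column `T + 3p - 2 - 2o`. If column `3T - 3p` comes earlier, the stretch between the two columns is
replaced by the detour. -/
theorem eq_of_isConstOn_upper (h : Params k T o) {p : ℕ} (hp : 1 + o ≤ p) (hpT : p ≤ T)
    (hs : IsConstOn T o s p) : s (x k p) = s (y k p) := by
  have h1 := h.eq; have h2 := h.le_one; have h3 := h.two_le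
  obtain ⟨hh, hv⟩ := hs
  rw [h.x_upper (by omega), h.y_upper (by omega) (by omega)]
  have e1 : s (p, T - p) = s (p, min (3 * T - 3 * p) (T + 3 * p - 2 - 2 * o)) := by
    refine eq_of_horizontal (by omega) fun c hc hc' => hh p c false ?_ ?_
    · unfold IsHor; omega
    · simp only [Owns, and_true]; omega
  have e4 : s (p, T + 3 * p - 2 - 2 * o) = s (2 * T + 1 - p, 3 * T + p - 2 - 2 * o) := by
    have e2 : s (p, T + 2 * p - 2 - 2 * o + p) =
        s (2 * T - p, T + 2 * p - 2 - 2 * o + (2 * T - p)) := by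
      refine eq_of_southEast (by omega) (fun r hr hr' => hv _ _ true ?_ ?_)
        (fun r hr hr' => hh _ _ true ?_ ?_)
      · unfold IsVer; omega
      · simp only [Owns, OwnsSE]; omega
      · unfold IsHor; omega
      · simp only [Owns, OwnsSE, OwnsSW]; omega
    have e3 := hv (2 * T - p) (3 * T + p - 2 - 2 * o) true (by unfold IsVer; omega)
      (by simp only [Owns, OwnsSE]; omega)
    rw [show T + 2 * p - 2 - 2 * o + p = T + 3 * p - 2 - 2 * o by omega,
      show T + 2 * p - 2 - 2 * o + (2 * T - p) = 3 * T + p - 2 - 2 * o by omega, e3] at e2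
    rw [e2]
    congr 2; omega
  rcases le_or_gt (T + 3 * p - 2 - 2 * o) (3 * T - 3 * p) with h4 | h4
  · rw [min_eq_right h4] at e1
    rw [e1, e4]
  rw [min_eq_left (by omega)] at e1
  rw [e1, ← e4]
  rw [show 3 * T - 3 * p = 3 * T - 2 * p - p by omega,
    h.eq_of_isConstOn_detour hp hpT h4 ⟨hh, hv⟩]
  congr 2; omega

/-- For odd `k` the walk of chord 1 is special: along path 1 to its last vertex, which carries no
chord, down a south-west stair to the central vertical edge, across it, and down a south-east stair
to `y`. -/
theorem eq_of_isConstOn_one (h : Params k T 1) (hs : IsConstOn T 1 s 1) :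
    s (x k 1) = s (y k 1) := by
  have h3 := h.two_le
  obtain ⟨hh, hv⟩ := hs
  rw [h.x_upper (by omega), h.y_upper (by omega) (by omega)]
  have e1 : s (1, T - 1) = s (1, 3 * T - 2 - 1) := by
    refine eq_of_horizontal (by omega) fun c hc hc' => hh 1 c false ?_ ?_
    · unfold IsHor; omega
    · exact ⟨by omega, Or.inl ⟨rfl, rfl, rfl⟩⟩
  have e2 : s (1, 3 * T - 2 - 1) = s (T, 3 * T - 2 - T) := by
    refine eq_of_southWest (by omega) (by omega) (fun r hr hr' => hv _ _ false ?_ ?_)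
      (fun r hr hr' => hh _ _ true ?_ ?_)
    · unfold IsVer; omega
    · simp only [Owns, OwnsSW, true_and]; omega
    · unfold IsHor; omega
    · simp only [Owns, OwnsSE, OwnsSW, true_and]; omega
  have e3 := hv T (3 * T - 2 - T) false (by unfold IsVer; omega)
    (by simp only [Owns, OwnsSW, true_and]; omega)
  have e4 := hh (T + 1) (3 * T - 2 - T) true (by unfold IsHor; omega)
    (by simp only [Owns, OwnsSE, OwnsSW, true_and]; omega)
  have e5 : s (T + 1, T - 2 + (T + 1)) = s (2 * T - 1, T - 2 + (2 * T - 1)) := by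
    refine eq_of_southEast (by omega) (fun r hr hr' => hv _ _ true ?_ ?_)
      (fun r hr hr' => hh _ _ true ?_ ?_)
    · unfold IsVer; omega
    · simp only [Owns, OwnsSE, true_and]; omega
    · unfold IsHor; omega
    · simp only [Owns, OwnsSE, OwnsSW, true_and]; omega
  have e6 := hv (2 * T - 1) (T - 2 + (2 * T - 1)) true (by unfold IsVer; omega)
    (by simp only [Owns, OwnsSE, true_and]; omega)
  rw [e1, e2, e3, e4, show 3 * T - 2 - T + 1 = T - 2 + (T + 1) by omega, e5, e6]
  congr 2 <;> omega

/-- Each colouring is violated in each of the walks. -/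
theorem exists_owns (h : Params k T o) (s : ℕ × ℕ → ZMod 2) {i : ℕ} (hi : 1 ≤ i)
    (hi' : i + o ≤ 2 * T) : ∃ e b, colBad k T o s e ∧ Owns T o e b i := by
  have h1 := h.eq; have h2 := h.le_one; have h3 := h.two_le
  by_contra hcon
  push Not at hcon
  have hs : IsConstOn T o s i := by
    constructor
    · intro p c b h1 h2
      by_contra h3
      exact hcon (.horizontal p c) b ⟨h1, h3⟩ h2
    · intro p c b h1 h2
      by_contra h3
      exact hcon (.vertical p c) b ⟨h1, h3⟩ h2
  refine hcon (.chord i) false ⟨⟨hi, hi'⟩, ?_⟩ rfl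
  rcases le_or_gt i T with h4 | h4
  · by_cases h5 : 1 + o ≤ i
    · exact h.eq_of_isConstOn_upper h5 h4 hs
    · obtain rfl : i = 1 := by omega
      obtain rfl : o = 1 := by omega
      exact h.eq_of_isConstOn_one hs
  · obtain ⟨p, rfl⟩ : ∃ p, i = 2 * T + 1 - p := ⟨2 * T + 1 - i, by omega⟩
    exact h.eq_of_isConstOn_lower (by omega) (by omega) hs

/-- Violated copies are chosen in the `k` walks, for `s` and for `s ∘ rot`; the latter are turned
back. By `owns_unique` and `not_owns_rotCopy` these `2k` copies are distinct, and each violated edge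
has only two copies. -/
theorem le_encard_bad (h : Params k T o) (s : ℕ × ℕ → ZMod 2) :
    (k : ℕ∞) ≤ ((signedWall k).bad s).encard := by
  have hk := h.eq
  rw [h.encard_bad]
  have : Nonempty (Edge × Bool) := ⟨(.chord 0, true)⟩
  have h1 : ∀ i ∈ Icc 1 k, ∃ t : Edge × Bool, colBad k T o s t.1 ∧ Owns T o t.1 t.2 i := by
    intro i hi
    obtain ⟨e, b, h2⟩ := h.exists_owns s hi.1 (by have := hi.2; omega)
    exact ⟨(e, b), h2⟩
  have h1' : ∀ i ∈ Icc 1 k, ∃ t : Edge × Bool, colBad k T o (s ∘ rot T o) t.1 ∧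
      Owns T o t.1 t.2 i := by
    intro i hi
    obtain ⟨e, b, h2⟩ := h.exists_owns (s ∘ rot T o) hi.1 (by have := hi.2; omega)
    exact ⟨(e, b), h2⟩
  choose! t ht using h1
  choose! t' ht' using h1'
  set S := {e | colBad k T o s e} with hS
  set u : ℕ → Edge × Bool := fun i => (rotEdge T o (t' i).1, rotCopy T o (t' i).1 (t' i).2)
    with hu
  have hinj : InjOn t (Icc 1 k) := by
    intro i hi j hj hij
    have h4 := ht i hi
    rw [hij] at h4
    exact h.owns_unique h4.1.isColEdge h4.2 (ht j hj).2
  have hcopy : ∀ e, Function.Injective (rotCopy T o e) := by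
    rintro (_ | _ | _) (_ | _) (_ | _) hb <;> simp only [rotCopy] at hb ⊢ <;> grind
  have hinj' : InjOn u (Icc 1 k) := by
    intro i hi j hj hij
    simp only [hu, Prod.mk.injEq] at hij
    obtain ⟨h4, h5⟩ := hij
    have h6 : (t' i).1 = (t' j).1 := by
      rw [← h.rotEdge_rotEdge (ht' i hi).1.isColEdge, h4,
        h.rotEdge_rotEdge (ht' j hj).1.isColEdge]
    rw [h6] at h5
    have h7 := (ht' i hi).2
    rw [h6, hcopy _ h5] at h7
    exact h.owns_unique (ht' j hj).1.isColEdge h7 (ht' j hj).2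
  have hdisj : Disjoint (t '' Icc 1 k) (u '' Icc 1 k) := by
    rw [Set.disjoint_left]
    rintro _ ⟨i, hi, rfl⟩ ⟨j, hj, hij⟩
    refine h.not_owns_rotCopy (ht' j hj).1.isColEdge (ht' j hj).2 (i' := i) ?_
    have := (ht i hi).2
    rw [← hij] at this
    exact this
  have hsub : t '' Icc 1 k ∪ u '' Icc 1 k ⊆
      (fun e => (e, false)) '' S ∪ (fun e => (e, true)) '' S := by
    have h8 : ∀ a : Edge × Bool, a.1 ∈ S →
        a ∈ (fun e => (e, false)) '' S ∪ (fun e => (e, true)) '' S := by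
      rintro ⟨e, _ | _⟩ ha
      · exact Or.inl ⟨e, ha, rfl⟩
      · exact Or.inr ⟨e, ha, rfl⟩
    rintro _ (⟨i, hi, rfl⟩ | ⟨i, hi, rfl⟩)
    · exact h8 _ (ht i hi).1
    · exact h8 _ ((h.colBad_rotEdge_iff (ht' i hi).1.isColEdge).1 (ht' i hi).1)
  have hcard : (Icc 1 k).encard = k := by
    rw [encard_eq_coe_toFinset_card]; simp
  have h9 := (encard_le_encard hsub).trans (encard_union_le _ _)
  rw [encard_union_eq hdisj, hinj.encard_image, hinj'.encard_image, hcard,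
    Function.Injective.encard_image (fun a b hab => congrArg Prod.fst hab),
    Function.Injective.encard_image (fun a b hab => congrArg Prod.fst hab)] at h9
  by_contra hlt
  push Not at hlt
  obtain ⟨n, hn⟩ := ENat.ne_top_iff_exists.1 (ne_top_of_lt hlt)
  rw [← hn] at h9 hlt
  norm_cast at h9 hlt
  omega

end Params

end Wall

/-! ### Criticality: curves with `k` violated edges -/

namespace Wall

variable {k T o : ℕ} {s : ℕ × ℕ → ZMod 2}

/-- The colouring of the vertices by the side of the curve `f` on which they lie. -/
def colour (f : ℕ → ℕ) (a : ℕ × ℕ) : ZMod 2 := if a.2 < f a.1 then 1 else 0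

theorem colour_eq_iff {f : ℕ → ℕ} {a b : ℕ × ℕ} :
    colour f a = colour f b ↔ (a.2 < f a.1 ↔ b.2 < f b.1) := by
  unfold colour
  split_ifs <;> simp_all
  omega

theorem colBad_horizontal {f : ℕ → ℕ} {p c : ℕ} :
    colBad k T o (colour f) (.horizontal p c) ↔ IsHor T o p c ∧ f p = c + 1 := by
  simp only [colBad, Ne, colour_eq_iff]
  exact and_congr_right fun _ => by omega

theorem colBad_vertical {f : ℕ → ℕ} {r c : ℕ} :
    colBad k T o (colour f) (.vertical r c) ↔
      IsVer T o r c ∧ ((c < f r ∧ f (r + 1) ≤ c) ∨ (c < f (r + 1) ∧ f r ≤ c)) := by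
  simp only [colBad, Ne, colour_eq_iff]
  exact and_congr_right fun _ => by omega

theorem Params.colBad_chord (h : Params k T o) {f : ℕ → ℕ} {i : ℕ} :
    colBad k T o (colour f) (.chord i) ↔ (1 ≤ i ∧ i + o ≤ 2 * T) ∧
      (T - min i (2 * T + 1 - i) < f i ↔
        3 * T + min i (2 * T + 1 - i) - 2 - 2 * o < f (2 * T + 1 - i)) := by
  have h1 := h.eq; have h2 := h.le_one; have h3 := h.two_le
  simp only [colBad, colour_eq_iff]
  refine and_congr_right fun hi => ?_
  rw [h.x_eq, h.y_eq]
  have : T - min (2 * T + 1 - i) (2 * T + 1 - (2 * T + 1 - i)) +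
      2 * (T - o + min (2 * T + 1 - i) (2 * T + 1 - (2 * T + 1 - i)) - 1) =
      3 * T + min i (2 * T + 1 - i) - 2 - 2 * o := by omega
  rw [this]

theorem encard_le_of_cover {S : Set Edge} (g g' g'' : ℕ → Edge) (n n' n'' : ℕ)
    (hn : n + n' + n'' ≤ k)
    (hS : ∀ e ∈ S, (∃ m < n, g m = e) ∨ (∃ m < n', g' m = e) ∨ ∃ m < n'', g'' m = e) :
    S.encard ≤ k := by
  have key : ∀ (g : ℕ → Edge) (n : ℕ), (g '' Iio n).encard ≤ n := by
    intro g n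
    refine (encard_image_le _ _).trans ?_
    rw [encard_eq_coe_toFinset_card]; simp
  have h1 : S ⊆ g '' Iio n ∪ g' '' Iio n' ∪ g'' '' Iio n'' := by
    intro e he
    rcases hS e he with ⟨m, hm, rfl⟩ | ⟨m, hm, rfl⟩ | ⟨m, hm, rfl⟩
    · exact Or.inl (Or.inl ⟨m, hm, rfl⟩)
    · exact Or.inl (Or.inr ⟨m, hm, rfl⟩)
    · exact Or.inr ⟨m, hm, rfl⟩
  calc S.encard ≤ _ := encard_le_encard h1
    _ ≤ (g '' Iio n).encard + (g' '' Iio n').encard + (g'' '' Iio n'').encard :=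
      (encard_union_le _ _).trans (by gcongr; exact encard_union_le _ _)
    _ ≤ n + n' + n'' := by gcongr <;> exact key _ _
    _ ≤ k := by exact_mod_cast hn

/-- The edge is violated by a colouring that violates at most `k` edges. -/
def IsTight (k T o : ℕ) (e : Edge) : Prop :=
  ∃ s, colBad k T o s e ∧ {e | colBad k T o s e}.encard ≤ k

namespace Params

theorem isTight_of_rotEdge (h : Params k T o) {e : Edge} (he : IsColEdge T o e)
    (ht : IsTight k T o (rotEdge T o e)) : IsTight k T o e := by
  obtain ⟨s, hs, hk⟩ := ht
  refine ⟨s ∘ rot T o, (h.colBad_rotEdge_iff he).2 hs, le_trans ?_ hk⟩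
  refine encard_le_encard_of_injOn (f := rotEdge T o) (fun e he => ?_) ?_
  · exact (h.colBad_rotEdge_iff he.isColEdge).1 he
  · intro e he e' he' hee
    rw [← h.rotEdge_rotEdge he.isColEdge, hee, h.rotEdge_rotEdge he'.isColEdge]

theorem isTight_chord (h : Params k T o) {i : ℕ} (hi : 1 ≤ i) (hi' : i + o ≤ 2 * T) :
    IsTight k T o (.chord i) := by
  have h1 := h.eq
  -- The constant colouring violates exactly the chords.
  refine ⟨colour fun _ => 0, ?_, ?_⟩
  · rw [h.colBad_chord]; simp [hi, hi']
  · refine encard_le_of_cover (fun m => .chord (m + 1)) (fun m => .chord m) (fun m => .chord m)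
      k 0 0 le_rfl fun e he => ?_
    rcases e with ⟨p, c⟩ | ⟨r, c⟩ | j
    · have := ((colBad_horizontal (k := k)).1 he).2
      omega
    · have := ((colBad_vertical (k := k)).1 he).2
      omega
    · have := (h.colBad_chord.1 he).1
      refine Or.inl ⟨j - 1, by omega, ?_⟩
      congr 1; omega

/-- The curve cuts the first `a` vertical edges of row `i`, then one horizontal edge in each of the
`2T - 2i` middle paths along a diagonal which parity keeps off the vertical edges, then the last `2i
- o - a` vertical edges of row `2T - i`: at most `2T - o = k` in all. No chord is violated. The
values `0` and `5T` put a whole path on one side. -/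
theorem encard_le_of_descending (h : Params k T o) {i a : ℕ} (hi : 1 ≤ i) (hiT : i ≤ T)
    (ha : a + o ≤ 2 * i) {f : ℕ → ℕ}
    (hf : ∀ p, (p ≤ i ∧ f p = 0) ∨
      (i < p ∧ p + i ≤ 2 * T ∧ f p + 2 * i + 1 = T + 2 * a + p) ∨
      (i < p ∧ 2 * T < p + i ∧ f p = 5 * T)) :
    {e | colBad k T o (colour f) e}.encard ≤ k := by
  have h1 := h.eq; have h2 := h.le_one; have h3 := h.two_le
  refine encard_le_of_cover (fun m => .horizontal (i + 1 + m) (T - i - 1 + 2 * a + m))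
    (fun m => .vertical i (T - i + 2 * m))
    (fun m => .vertical (2 * T - i) (3 * T - 3 * i + 2 * a + 2 * m))
    (2 * T - 2 * i) a (2 * i - o - a) (by omega) fun e he => ?_
  rcases e with ⟨p, c⟩ | ⟨r, c⟩ | j
  · obtain ⟨h4, h5⟩ := (colBad_horizontal (k := k)).1 he
    have h6 := hf p
    unfold IsHor at h4
    refine Or.inl ⟨p - i - 1, by omega, ?_⟩
    congr 1 <;> omega
  · obtain ⟨h4, h5⟩ := (colBad_vertical (k := k)).1 he
    have h6 := hf r
    have h7 := hf (r + 1)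
    unfold IsVer at h4
    by_cases h8 : r = i ∧ c < T - i + 2 * a
    · refine Or.inr (Or.inl ⟨(c - (T - i)) / 2, by omega, ?_⟩)
      congr 1 <;> omega
    · have h9 : r = 2 * T - i ∧ 3 * T - 3 * i + 2 * a ≤ c := by omega
      refine Or.inr (Or.inr ⟨(c - (3 * T - 3 * i + 2 * a)) / 2, by omega, ?_⟩)
      congr 1 <;> omega
  · obtain ⟨h4, h5⟩ := h.colBad_chord.1 he
    have h6 := hf j
    have h7 := hf (2 * T + 1 - j)
    omega

/-- The mirror image of the descending curve: it enters through the last vertical edges of row `i`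
and leaves through the first `u` of row `2T - i`. -/
theorem encard_le_of_ascending (h : Params k T o) {i u : ℕ} (hi : 1 ≤ i) (hiT : i ≤ T)
    (hu : u + o ≤ 2 * i) {f : ℕ → ℕ}
    (hf : ∀ p, (p ≤ i ∧ f p = 5 * T) ∨
      (i < p ∧ p + i ≤ 2 * T ∧ f p + 2 * i + p = 3 * T + 2 * u) ∨
      (i < p ∧ 2 * T < p + i ∧ f p = 0)) :
    {e | colBad k T o (colour f) e}.encard ≤ k := by
  have h1 := h.eq; have h2 := h.le_one; have h3 := h.two_le
  refine encard_le_of_cover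
    (fun m => .horizontal (i + 1 + m) (3 * T + 2 * u - 2 * i - (i + 1 + m) - 1))
    (fun m => .vertical i (3 * T - 3 * i + 2 * u + 2 * m))
    (fun m => .vertical (2 * T - i) (T - i + 2 * m))
    (2 * T - 2 * i) (2 * i - o - u) u (by omega) fun e he => ?_
  rcases e with ⟨p, c⟩ | ⟨r, c⟩ | j
  · obtain ⟨h4, h5⟩ := (colBad_horizontal (k := k)).1 he
    have h6 := hf p
    unfold IsHor at h4
    refine Or.inl ⟨p - i - 1, by omega, ?_⟩
    congr 1 <;> omega
  · obtain ⟨h4, h5⟩ := (colBad_vertical (k := k)).1 he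
    have h6 := hf r
    have h7 := hf (r + 1)
    unfold IsVer at h4
    by_cases h8 : r = i ∧ 3 * T - 3 * i + 2 * u ≤ c
    · refine Or.inr (Or.inl ⟨(c - (3 * T - 3 * i + 2 * u)) / 2, by omega, ?_⟩)
      congr 1 <;> omega
    · have h9 : r = 2 * T - i ∧ c < T - i + 2 * u := by omega
      refine Or.inr (Or.inr ⟨(c - (T - i)) / 2, by omega, ?_⟩)
      congr 1 <;> omega
  · obtain ⟨h4, h5⟩ := h.colBad_chord.1 he
    have h6 := hf j
    have h7 := hf (2 * T + 1 - j)
    omega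

/-- A curve that avoids vertical edges cuts at most one edge of each path; for odd `k` it must also
miss path `2T`, since only `k` violated edges are allowed. -/
theorem encard_le_of_horizontal (h : Params k T o) {f : ℕ → ℕ}
    (hh : ∀ p c, IsHor T o p c → f p = c + 1 → p + o ≤ 2 * T)
    (hv : ∀ r c, IsVer T o r c → (c < f r ↔ c < f (r + 1)))
    (hc : ∀ i, 1 ≤ i → i + o ≤ 2 * T → T - min i (2 * T + 1 - i) < f i ∧
        f (2 * T + 1 - i) ≤ 3 * T + min i (2 * T + 1 - i) - 2 - 2 * o) :
    {e | colBad k T o (colour f) e}.encard ≤ k := by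
  have h1 := h.eq
  refine encard_le_of_cover (fun m => .horizontal (m + 1) (f (m + 1) - 1))
    (fun m => .chord m) (fun m => .chord m) k 0 0 le_rfl fun e he => ?_
  rcases e with ⟨p, c⟩ | ⟨r, c⟩ | j
  · obtain ⟨h4, h5⟩ := (colBad_horizontal (k := k)).1 he
    have h6 := hh p c h4 h5
    unfold IsHor at h4
    refine Or.inl ⟨p - 1, by omega, ?_⟩
    have h7 : p - 1 + 1 = p := by omega
    simp only [h7, h5, Nat.add_sub_cancel]
  · obtain ⟨h4, h5⟩ := (colBad_vertical (k := k)).1 he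
    have h6 := hv r c h4
    omega
  · obtain ⟨h4, h5⟩ := h.colBad_chord.1 he
    have h6 := hc j h4.1 h4.2
    omega

/-- A diagonal curve may cut all of the first kept edges of a row and none in the opposite row; the
last kept edges follow by a half-turn. -/
theorem isTight_vertical (h : Params k T o) {r c : ℕ} (hrc : IsVer T o r c) :
    IsTight k T o (.vertical r c) := by
  have h1 := h.eq; have h2 := h.le_one; have h3 := h.two_le
  have key : ∀ r c, IsVer T o r c → c + 2 * o < T + 3 * r → c + 2 * o + 3 * r < 7 * T →
      IsTight k T o (.vertical r c) := by
    intro r c hrc h4 h5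
    have h6 := id hrc
    unfold IsVer at h6
    rcases le_or_gt r T with h7 | h7
    · set f : ℕ → ℕ := fun p => if p ≤ r then 0 else if p + r ≤ 2 * T then
        T + 2 * (2 * r - o) + p - 2 * r - 1 else 5 * T with hf
      have hf' : ∀ p, (p ≤ r ∧ f p = 0) ∨
          (r < p ∧ p + r ≤ 2 * T ∧ f p + 2 * r + 1 = T + 2 * (2 * r - o) + p) ∨
          (r < p ∧ 2 * T < p + r ∧ f p = 5 * T) := by
        intro p
        simp only [hf]
        split_ifs <;> omega
      refine ⟨colour f, colBad_vertical.2 ⟨hrc, ?_⟩,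
        h.encard_le_of_descending (i := r) (by omega) h7 (by omega) hf'⟩
      have := hf' r
      have := hf' (r + 1)
      omega
    · obtain ⟨i, hi⟩ : ∃ i, i = 2 * T - r := ⟨_, rfl⟩
      set f : ℕ → ℕ := fun p => if p ≤ i then 5 * T else if p + i ≤ 2 * T then
        3 * T + 2 * (2 * i - o) - 2 * i - p else 0 with hf
      have hf' : ∀ p, (p ≤ i ∧ f p = 5 * T) ∨
          (i < p ∧ p + i ≤ 2 * T ∧ f p + 2 * i + p = 3 * T + 2 * (2 * i - o)) ∨
          (i < p ∧ 2 * T < p + i ∧ f p = 0) := by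
        intro p
        simp only [hf]
        split_ifs <;> omega
      refine ⟨colour f, colBad_vertical.2 ⟨hrc, ?_⟩,
        h.encard_le_of_ascending (i := i) (by omega) (by omega) (by omega) hf'⟩
      have := hf' r
      have := hf' (r + 1)
      omega
  have h6 := id hrc
  unfold IsVer at h6
  by_cases h4 : c + 2 * o < T + 3 * r ∧ c + 2 * o + 3 * r < 7 * T
  · exact key r c hrc h4.1 h4.2
  · refine h.isTight_of_rotEdge hrc (key _ _ (h.isColEdge_rotEdge (e := .vertical r c) hrc) ?_ ?_)
    · omega
    · omega

/-- For one parity the edge is where a diagonal curve meets a block of cut vertical edges. For the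
other, a curve bent at this edge has both arms running to the right along diagonals free of vertical
edges. -/
theorem isTight_horizontal_left (h : Params k T o) {p c : ℕ} (hpc : IsHor T o p c)
    (hc : c + 1 < T) : IsTight k T o (.horizontal p c) := by
  have h1 := h.eq; have h2 := h.le_one; have h3 := h.two_le
  have h6 := id hpc
  unfold IsHor at h6
  by_cases hpar : (p ≤ T ∧ (c + p + T) % 2 = 0) ∨ (T < p ∧ (c + p + T) % 2 = 1)
  · rcases hpar with ⟨h7, h8⟩ | ⟨h7, h8⟩
    · obtain ⟨i, rfl⟩ : ∃ i, p = i + 1 := ⟨p - 1, by omega⟩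
      obtain ⟨a, ha⟩ : ∃ a, c + i + 1 = T + 2 * a := ⟨(c + i + 1 - T) / 2, by omega⟩
      set f : ℕ → ℕ := fun p => if p ≤ i then 0 else if p + i ≤ 2 * T then
        T + 2 * a + p - 2 * i - 1 else 5 * T with hf
      have hf' : ∀ p, (p ≤ i ∧ f p = 0) ∨
          (i < p ∧ p + i ≤ 2 * T ∧ f p + 2 * i + 1 = T + 2 * a + p) ∨
          (i < p ∧ 2 * T < p + i ∧ f p = 5 * T) := by
        intro p
        simp only [hf]
        split_ifs <;> omega
      refine ⟨colour f, colBad_horizontal.2 ⟨hpc, ?_⟩,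
        h.encard_le_of_descending (i := i) (by omega) (by omega) (by omega) hf'⟩
      have := hf' (i + 1)
      omega
    · obtain ⟨i, hi⟩ : ∃ i, i = 2 * T - p := ⟨_, rfl⟩
      obtain ⟨u, hu⟩ : ∃ u, c + i + 1 = T + 2 * u := ⟨(c + i + 1 - T) / 2, by omega⟩
      set f : ℕ → ℕ := fun p => if p ≤ i then 5 * T else if p + i ≤ 2 * T then
        3 * T + 2 * u - 2 * i - p else 0 with hf
      have hf' : ∀ p, (p ≤ i ∧ f p = 5 * T) ∨
          (i < p ∧ p + i ≤ 2 * T ∧ f p + 2 * i + p = 3 * T + 2 * u) ∨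
          (i < p ∧ 2 * T < p + i ∧ f p = 0) := by
        intro p
        simp only [hf]
        split_ifs <;> omega
      refine ⟨colour f, colBad_horizontal.2 ⟨hpc, ?_⟩,
        h.encard_le_of_ascending (i := i) (by omega) (by omega) (by omega) hf'⟩
      have := hf' p
      omega
  · rcases le_or_gt p T with h7 | h7
    · set f : ℕ → ℕ := fun r => min (if r ≤ p then c + 1 + p - r else c + r - p)
        -- For odd `k` this cap bends the curve along an antidiagonal without vertical edges, so
        -- that it passes to the left of all of path `2T`.
        (if o = 1 then 3 * T - 2 - r else 5 * T) with hf
      have hf' : ∀ r, (o = 1 ∧ r ≤ p ∧ f r = min (c + 1 + p - r) (3 * T - 2 - r)) ∨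
          (o = 1 ∧ p < r ∧ f r = min (c + r - p) (3 * T - 2 - r)) ∨
          (o = 0 ∧ r ≤ p ∧ f r = min (c + 1 + p - r) (5 * T)) ∨
          (o = 0 ∧ p < r ∧ f r = min (c + r - p) (5 * T)) := by
        intro r
        simp only [hf]
        split_ifs <;> omega
      refine ⟨colour f, colBad_horizontal.2 ⟨hpc, ?_⟩, h.encard_le_of_horizontal ?_ ?_ ?_⟩
      · have := hf' p
        omega
      · intro r c hrc hfr
        have := hf' r
        unfold IsHor at hrc
        omega
      · intro r c hrc
        have := hf' r
        have := hf' (r + 1)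
        unfold IsVer at hrc
        omega
      · intro i hi hi'
        have := hf' i
        have := hf' (2 * T + 1 - i)
        omega
    · set f : ℕ → ℕ := fun r => min (if p ≤ r then c + 1 + r - p else c + p - r)
        (if o = 1 then 3 * T - 2 - r else 5 * T) with hf
      have hf' : ∀ r, (o = 1 ∧ p ≤ r ∧ f r = min (c + 1 + r - p) (3 * T - 2 - r)) ∨
          (o = 1 ∧ r < p ∧ f r = min (c + p - r) (3 * T - 2 - r)) ∨
          (o = 0 ∧ p ≤ r ∧ f r = min (c + 1 + r - p) (5 * T)) ∨
          (o = 0 ∧ r < p ∧ f r = min (c + p - r) (5 * T)) := by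
        intro r
        simp only [hf]
        split_ifs <;> omega
      refine ⟨colour f, colBad_horizontal.2 ⟨hpc, ?_⟩, h.encard_le_of_horizontal ?_ ?_ ?_⟩
      · have := hf' p
        omega
      · intro r c hrc hfr
        have := hf' r
        unfold IsHor at hrc
        omega
      · intro r c hrc
        have := hf' r
        have := hf' (r + 1)
        unfold IsVer at hrc
        omega
      · intro i hi hi'
        have := hf' i
        have := hf' (2 * T + 1 - i)
        omega

/-- This edge lies just beyond the cap used for odd `k`. The curve instead cuts the first vertical
edge of row 1, runs straight down column `c` and then along a descending diagonal, cutting paths `2`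
to `2T - 1`: `1 + (2T - 2) = k` edges. -/
theorem isTight_horizontal_steep (h : Params k T 1) {p c : ℕ} (hpc : IsHor T 1 p c)
    (hp : p ≤ T) (hc : T ≤ c + 1) (hpc' : c + p + 2 = 3 * T) :
    IsTight k T 1 (.horizontal p c) := by
  have h1 := h.eq; have h3 := h.two_le
  have h6 := id hpc
  unfold IsHor at h6
  set f : ℕ → ℕ := fun r => if r ≤ 1 then 0 else if r < 2 * T then
    max (c + 1) (r + T - 1) else 5 * T with hf
  have hf' : ∀ r, (r ≤ 1 ∧ f r = 0) ∨
      (1 < r ∧ r < 2 * T ∧ f r = max (c + 1) (r + T - 1)) ∨ (2 * T ≤ r ∧ f r = 5 * T) := by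
    intro r
    simp only [hf]
    split_ifs <;> omega
  refine ⟨colour f, colBad_horizontal.2 ⟨hpc, ?_⟩, ?_⟩
  · have := hf' p
    omega
  refine encard_le_of_cover (fun m => .horizontal (m + 2) (max c (m + T)))
    (fun _ => .vertical 1 (T - 1)) (fun _ => .chord 0) (2 * T - 2) 1 0 (by omega) fun e he => ?_
  rcases e with ⟨p, c⟩ | ⟨r, c⟩ | j
  · obtain ⟨h4, h5⟩ := (colBad_horizontal (k := k)).1 he
    have := hf' p
    unfold IsHor at h4
    refine Or.inl ⟨p - 2, by omega, ?_⟩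
    congr 1 <;> omega
  · obtain ⟨h4, h5⟩ := (colBad_vertical (k := k)).1 he
    have := hf' r
    have := hf' (r + 1)
    unfold IsVer at h4
    refine Or.inr (Or.inl ⟨0, by omega, ?_⟩)
    congr 1 <;> omega
  · obtain ⟨h4, h5⟩ := h.colBad_chord.1 he
    have := hf' j
    have := hf' (2 * T + 1 - j)
    omega

/-- A straight vertical curve cuts each path once and no vertical edge; for odd `k` it is capped,
and the last hypothesis says that the cap does not yet act at path `p`. -/
theorem isTight_horizontal_middle (h : Params k T o) {p c : ℕ} (hpc : IsHor T o p c)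
    (hc : T ≤ c + 1) (hc' : c + 1 + 2 * o < 3 * T) (hpc' : o = 1 → c + p + 3 ≤ 3 * T) :
    IsTight k T o (.horizontal p c) := by
  have h1 := h.eq; have h2 := h.le_one; have h3 := h.two_le
  have h6 := id hpc
  unfold IsHor at h6
  set f : ℕ → ℕ := fun r => min (c + 1) (if o = 1 then 3 * T - 2 - r else 5 * T) with hf
  have hf' : ∀ r, (o = 1 ∧ f r = min (c + 1) (3 * T - 2 - r)) ∨
      (o = 0 ∧ f r = min (c + 1) (5 * T)) := by
    intro r
    simp only [hf]
    split_ifs <;> omega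
  refine ⟨colour f, colBad_horizontal.2 ⟨hpc, ?_⟩, h.encard_le_of_horizontal ?_ ?_ ?_⟩
  · have := hf' p
    omega
  · intro r c hrc hfr
    have := hf' r
    unfold IsHor at hrc
    omega
  · intro r c hrc
    have := hf' r
    have := hf' (r + 1)
    unfold IsVer at hrc
    omega
  · intro i hi hi'
    have := hf' i
    have := hf' (2 * T + 1 - i)
    omega

theorem isTight_horizontal (h : Params k T o) {p c : ℕ} (hpc : IsHor T o p c) :
    IsTight k T o (.horizontal p c) := by
  have h1 := h.eq; have h2 := h.le_one; have h3 := h.two_le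
  have h6 := id hpc
  unfold IsHor at h6
  have hrot := h.isTight_of_rotEdge (e := .horizontal p c) hpc
  have hpc' : IsHor T o (2 * T + 1 - p) (4 * T - 3 - 2 * o - c) :=
    h.isColEdge_rotEdge (e := .horizontal p c) hpc
  rcases lt_or_ge (c + 1) T with h4 | h4
  · exact h.isTight_horizontal_left hpc h4
  rcases lt_or_ge (c + 1 + 2 * o) (3 * T) with h5 | h5
  swap
  · exact hrot (h.isTight_horizontal_left hpc' (by omega))
  by_cases h7 : o = 1 → c + p + 3 ≤ 3 * T
  · exact h.isTight_horizontal_middle hpc h4 h5 h7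
  push Not at h7
  obtain ⟨rfl, h7⟩ := h7
  -- The half-turn exchanges the two sides of this antidiagonal, so only edges on it need the
  -- special curve.
  by_cases h8 : c + p + 2 = 3 * T
  · rcases le_or_gt p T with h9 | h9
    · exact h.isTight_horizontal_steep hpc h9 h4 h8
    · exact hrot (h.isTight_horizontal_steep hpc' (by omega) (by omega) (by omega))
  · exact hrot (h.isTight_horizontal_middle hpc' (by omega) (by omega) fun _ => by omega)

theorem isTight (h : Params k T o) {e : Edge} (he : IsColEdge T o e) : IsTight k T o e := by
  rcases e with ⟨p, c⟩ | ⟨r, c⟩ | i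
  · exact h.isTight_horizontal he
  · exact h.isTight_vertical he
  · exact h.isTight_chord he.1 he.2

theorem isColEdge_toCol (h : Params k T o) {e : Edge} (he : IsEdge k e) :
    IsColEdge T o (toCol k e) := by
  rcases e with ⟨p, c⟩ | ⟨r, c⟩ | i
  · exact (h.isEdge_horizontal p c).1 he
  · exact (h.isEdge_vertical r c).1 he
  · exact (h.isEdge_chord i).1 he

theorem exists_mem_bad_encard_le (h : Params k T o) {e : Edge} (he : IsEdge k e) :
    ∃ s, e ∈ (signedWall k).bad s ∧ ((signedWall k).bad s).encard ≤ k := by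
  have h1 := h.isColEdge_toCol he
  obtain ⟨s, hs, hk⟩ := h.isTight h1
  refine ⟨s, ?_, by rwa [h.encard_bad]⟩
  have h2 : toCol k e ∈ toCol k '' (signedWall k).bad s := by
    rw [h.toCol_image_bad]; exact hs
  obtain ⟨e', he', h3⟩ := h2
  rwa [← toCol_injective h3]

end Params

end Wall

/-! ### Two negative even sets intersect -/

namespace Wall

variable {k T o : ℕ}

/-- The boundary map of the wall modulo two. -/
noncomputable def boundary (k : ℕ) (e : Edge) (z : ℕ × ℕ) : ZMod 2 :=
  SignedGraph.vind (ends k e).1 z + SignedGraph.vind (ends k e).2 z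

theorem isBoundary_boundary : SignedGraph.IsBoundary (signedWall k).graph (boundary k) := by
  rintro e a b ⟨-, h | h⟩ z
  · rw [boundary, h]
  · rw [boundary, h, add_comm]

/-- The edge that enters `(p, c)` from the left, where the paths are extended by chords. -/
def leftEdge (T o p c : ℕ) : Edge :=
  if c ≤ T - min p (2 * T + 1 - p) then .chord p
  else if c ≤ 3 * T + min p (2 * T + 1 - p) - 2 - 2 * o then .horizontal p (c - 1)
  else .chord (2 * T + 1 - p)

open Classical in
/-- The indicator modulo two of a set of edges at an edge that is named by its column. -/
noncomputable def ind (k : ℕ) (Z : Finset Edge) (e : Edge) : ZMod 2 :=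
  ∑ f ∈ Z, if toCol k f = e then 1 else 0

/-- A set of edges of the wall that meets each vertex an even number of times. -/
structure IsEvenSet (k : ℕ) (Z : Finset Edge) : Prop where
  isEdge : ∀ e ∈ Z, IsEdge k e
  even : ∀ z, ∑ e ∈ Z, boundary k e z = 0

theorem ind_of_mem {Z : Finset Edge} {e : Edge} (he : e ∈ Z) : ind k Z (toCol k e) = 1 := by
  classical
  rw [ind, Finset.sum_eq_single e, if_pos rfl]
  · intro f _ hf
    exact if_neg fun h => hf (toCol_injective h)
  · exact fun h => (h he).elim

theorem ind_eq_zero {Z : Finset Edge} {e : Edge} (he : ∀ f ∈ Z, toCol k f ≠ e) :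
    ind k Z e = 0 :=
  Finset.sum_eq_zero fun f hf => if_neg (he f hf)

theorem ind_mul_ind {Z U : Finset Edge} (h : Disjoint Z U) (e : Edge) :
    ind k Z e * ind k U e = 0 := by
  by_cases h1 : ∃ f ∈ Z, toCol k f = e
  · obtain ⟨f, hf, rfl⟩ := h1
    rw [ind_eq_zero (Z := U), mul_zero]
    intro g hg hgf
    rw [toCol_injective hgf] at hg
    exact Finset.disjoint_left.1 h hf hg
  · push Not at h1
    rw [ind_eq_zero h1, zero_mul]

/-- At a vertex with at most three edges, an even set that is present uses two of them, leaving at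
most one to a disjoint even set, hence none. -/
theorem eq_zero_of_degree_three {a a' b b' c c' d d' : ZMod 2} (ha : a * a' = 0)
    (hb : b * b' = 0) (hc : c * c' = 0) (hd : d * d' = 0) (h : a + b + c + d = 0)
    (h' : a' + b' + c' + d' = 0) (hcd : (c = 0 ∧ c' = 0) ∨ (d = 0 ∧ d' = 0))
    (hne : a' = 1 ∨ b' = 1 ∨ c' = 1 ∨ d' = 1) : a = 0 ∧ b = 0 ∧ c = 0 ∧ d = 0 := by
  revert a a' b b' c c' d d'
  decide

theorem ite_add_ite {P Q R S : Prop} [Decidable P] [Decidable Q] [Decidable R] [Decidable S]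
    (hR : R ↔ P ∧ ¬ Q) (hS : S ↔ ¬ P ∧ Q) :
    ((if R then 1 else 0) + (if S then 1 else 0) : ZMod 2) =
      (if P then 1 else 0) + (if Q then 1 else 0) := by
  by_cases hP : P <;> by_cases hQ : Q <;> simp [hR, hS, hP, hQ]
  decide

namespace Params

theorem horizontal_eq_leftEdge (h : Params k T o) {p c p' c' : ℕ} (hp : IsHor T o p' c') :
    Edge.horizontal p' c' = leftEdge T o p c ↔ p' = p ∧ c' + 1 = c := by
  have h1 := h.eq; have h2 := h.le_one; have h3 := h.two_le
  unfold IsHor at hp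
  unfold leftEdge
  split_ifs <;> simp only [Edge.horizontal.injEq, false_iff] <;> omega

theorem vertical_ne_leftEdge {p c r c' : ℕ} : Edge.vertical r c' ≠ leftEdge T o p c := by
  unfold leftEdge
  split_ifs <;> simp

theorem chord_eq_leftEdge (h : Params k T o) {p c i : ℕ} (hi : 1 ≤ i) (hi' : i + o ≤ 2 * T)
    (hp : 1 ≤ p) : Edge.chord i = leftEdge T o p c ↔
      (c ≤ T - min i (2 * T + 1 - i) ∧ p = i) ∨
      (3 * T + min i (2 * T + 1 - i) - 2 - 2 * o < c ∧ p + i = 2 * T + 1) := by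
  have h1 := h.eq; have h2 := h.le_one; have h3 := h.two_le
  unfold leftEdge
  split_ifs <;> simp only [Edge.chord.injEq, false_iff] <;> omega

theorem y_eq' (h : Params k T o) {i : ℕ} (hi : 1 ≤ i) :
    y k i = (2 * T + 1 - i, 3 * T + min i (2 * T + 1 - i) - 2 - 2 * o) := by
  have h1 := h.eq; have h2 := h.le_one; have h3 := h.two_le
  rw [h.y_eq]
  congr 1; omega

-- Outside the wall a chord is both the edge entering a grid point and the edge leaving it, and the
-- two contributions cancel. So the vertex condition holds at every grid point, also beyond the ends
-- of the paths.
open Classical in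
theorem boundary_eq (h : Params k T o) {e : Edge} (he : IsEdge k e) {p c : ℕ} (hp : 1 ≤ p) :
    boundary k e (p, c) = (if toCol k e = leftEdge T o p c then 1 else 0) +
      (if toCol k e = leftEdge T o p (c + 1) then 1 else 0) +
      (if toCol k e = .vertical p c then 1 else 0) +
      (if toCol k e = .vertical (p - 1) c then 1 else 0) := by
  have h1 := h.eq; have h2 := h.le_one; have h3 := h.two_le
  unfold boundary SignedGraph.vind
  rcases e with ⟨p', c'⟩ | ⟨r, j⟩ | i
  · rw [h.isEdge_horizontal] at he
    simp only [toCol, ends, Prod.mk.injEq, h.horizontal_eq_leftEdge he, reduceCtorEq, if_false,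
      add_zero, Nat.add_right_cancel_iff]
    exact add_comm _ _
  · simp only [toCol, ends, Prod.mk.injEq, vertical_ne_leftEdge, if_false, zero_add,
      Edge.vertical.injEq]
    have h4 : r + 1 = p ↔ r = p - 1 := by omega
    simp only [h4, col]
    congr!
  · rw [h.isEdge_chord] at he
    have h6 : (ends k (.chord i)) = (x k i, y k i) := rfl
    simp only [toCol, h6, h.x_eq, h.y_eq' he.1, Prod.mk.injEq, reduceCtorEq, if_false,
      add_zero, h.chord_eq_leftEdge he.1 he.2 hp]
    exact ite_add_ite (by omega) (by omega)

theorem sum_ind_eq_zero (h : Params k T o) {Z : Finset Edge} (hZ : IsEvenSet k Z) {p c : ℕ}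
    (hp : 1 ≤ p) : ind k Z (leftEdge T o p c) + ind k Z (leftEdge T o p (c + 1)) +
      ind k Z (.vertical p c) + ind k Z (.vertical (p - 1) c) = 0 := by
  rw [← hZ.even (p, c), Finset.sum_congr rfl fun e he => h.boundary_eq (hZ.isEdge e he) hp]
  simp only [Finset.sum_add_distrib, ind]

theorem ind_vertical (h : Params k T o) {Z : Finset Edge} (hZ : IsEvenSet k Z) {r c : ℕ}
    (hrc : ¬ IsVer T o r c) : ind k Z (.vertical r c) = 0 := by
  refine ind_eq_zero fun f hf hfe => ?_
  have h1 := hZ.isEdge f hf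
  rcases f with ⟨p', c'⟩ | ⟨r', j⟩ | i <;>
    simp only [toCol, Edge.vertical.injEq, reduceCtorEq] at hfe
  obtain ⟨rfl, rfl⟩ := hfe
  exact hrc ((h.isEdge_vertical _ _).1 h1)

/-- Disjoint even sets of edges have no vertex in common. -/
theorem ind_eq_zero_of_disjoint (h : Params k T o) {Z U : Finset Edge} (hZ : IsEvenSet k Z)
    (hU : IsEvenSet k U) (hd : Disjoint Z U) {e : Edge} (he : e ∈ U) {p c : ℕ} (hp : 1 ≤ p)
    (hpc : leftEdge T o p c = toCol k e ∨ leftEdge T o p (c + 1) = toCol k e ∨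
      .vertical p c = toCol k e ∨ .vertical (p - 1) c = toCol k e) :
    ind k Z (leftEdge T o p c) = 0 ∧ ind k Z (leftEdge T o p (c + 1)) = 0 ∧
      ind k Z (.vertical p c) = 0 ∧ ind k Z (.vertical (p - 1) c) = 0 := by
  refine eq_zero_of_degree_three (ind_mul_ind hd _) (ind_mul_ind hd _) (ind_mul_ind hd _)
    (ind_mul_ind hd _) (h.sum_ind_eq_zero hZ hp) (h.sum_ind_eq_zero hU hp) ?_ ?_
  · by_cases h1 : IsVer T o p c
    · have h2 : ¬ IsVer T o (p - 1) c := by unfold IsVer at h1 ⊢; omega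
      exact Or.inr ⟨h.ind_vertical hZ h2, h.ind_vertical hU h2⟩
    · exact Or.inl ⟨h.ind_vertical hZ h1, h.ind_vertical hU h1⟩
  · have h1 := ind_of_mem (k := k) he
    rcases hpc with h2 | h2 | h2 | h2
    · exact Or.inl (h2 ▸ h1)
    · exact Or.inr (Or.inl (h2 ▸ h1))
    · exact Or.inr (Or.inr (Or.inl (h2 ▸ h1)))
    · exact Or.inr (Or.inr (Or.inr (h2 ▸ h1)))

end Params

/-- The number modulo two of edges of `Z` that enter column `c` from the left in the paths up
to `p`. -/
noncomputable def crossing (k T o : ℕ) (Z : Finset Edge) (p c : ℕ) : ZMod 2 :=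
  ∑ q ∈ Finset.Icc 1 p, ind k Z (leftEdge T o q c)

namespace Params

theorem crossing_succ {Z : Finset Edge} (p c : ℕ) : crossing k T o Z (p + 1) c =
    crossing k T o Z p c + ind k Z (leftEdge T o (p + 1) c) :=
  Finset.sum_Icc_succ_top (by omega) _

/-- Conservation modulo two: summing the vertex conditions over the top `p` points of column `c`,
the inner vertical edges cancel and only the one leaving downwards remains. -/
theorem crossing_add_crossing (h : Params k T o) {Z : Finset Edge} (hZ : IsEvenSet k Z)
    (p c : ℕ) : crossing k T o Z p c + crossing k T o Z p (c + 1) =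
      ind k Z (.vertical p c) := by
  induction p with
  | zero =>
    rw [h.ind_vertical hZ (by unfold IsVer; omega)]
    simp [crossing]
  | succ p ih =>
    have h1 := h.sum_ind_eq_zero hZ (p := p + 1) (c := c) (by omega)
    rw [crossing_succ, crossing_succ]
    rw [Nat.add_sub_cancel, ← ih] at h1
    revert h1
    generalize ind k Z (leftEdge T o (p + 1) c) = a1
    generalize ind k Z (leftEdge T o (p + 1) (c + 1)) = a2
    generalize crossing k T o Z p c = a3
    generalize crossing k T o Z p (c + 1) = a4
    generalize ind k Z (.vertical (p + 1) c) = a5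
    revert a1 a2 a3 a4 a5
    decide

theorem crossing_eq (h : Params k T o) {Z : Finset Edge} (hZ : IsEvenSet k Z)
    {p c c' : ℕ} (hc : c ≤ c') (hv : ∀ j, c ≤ j → j < c' → ind k Z (.vertical p j) = 0) :
    crossing k T o Z p c = crossing k T o Z p c' := by
  induction c', hc using Nat.le_induction with
  | base => rfl
  | succ n hn ih =>
    rw [ih fun j h1 h2 => hv j h1 (by omega)]
    have h1 := h.crossing_add_crossing hZ p n
    rw [hv n hn (by omega)] at h1
    exact SignedGraph.zmod_two_add_eq_zero h1

theorem sum_sign (h : Params k T o) {Z : Finset Edge} (hZ : IsEvenSet k Z) :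
    ∑ i ∈ Finset.Icc 1 (2 * T), ind k Z (.chord i) = ∑ e ∈ Z, (signedWall k).sign e := by
  classical
  have h1 := h.eq
  simp only [ind]
  rw [Finset.sum_comm]
  refine Finset.sum_congr rfl fun e he => ?_
  have he := hZ.isEdge e he
  rcases e with ⟨p', c'⟩ | ⟨r', j⟩ | i
  · rw [sign_horizontal]; exact Finset.sum_eq_zero fun i _ => if_neg (by simp [toCol])
  · rw [sign_vertical]; exact Finset.sum_eq_zero fun i _ => if_neg (by simp [toCol])
  · rw [sign_chord he]
    rw [h.isEdge_chord] at he
    rw [Finset.sum_eq_single i]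
    · exact if_pos rfl
    · intro j _ hj
      refine if_neg fun hij => hj ?_
      simpa [toCol] using hij.symm
    · intro hi
      exact (hi (Finset.mem_Icc.2 ⟨he.1, by omega⟩)).elim

theorem crossing_zero (p : ℕ) (Z : Finset Edge) :
    crossing k T o Z p 0 = ∑ i ∈ Finset.Icc 1 p, ind k Z (.chord i) := by
  refine Finset.sum_congr rfl fun q _ => ?_
  rw [leftEdge, if_pos (Nat.zero_le _)]

/-- Column `5T` is beyond all paths, and there path `q` is continued by chord `2T + 1 - q`. The
order of the chords is reversed between the two sides: this is the crosscap. -/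
theorem crossing_last (h : Params k T o) {i : ℕ} (hi : 1 ≤ i) (hi' : i ≤ 2 * T)
    (Z : Finset Edge) :
    crossing k T o Z (2 * T + 1 - i) (5 * T) =
      ∑ j ∈ Finset.Icc i (2 * T), ind k Z (.chord j) := by
  have h1 := h.eq; have h2 := h.le_one; have h3 := h.two_le
  refine Finset.sum_bij' (fun q _ => 2 * T + 1 - q) (fun q _ => 2 * T + 1 - q) ?_ ?_ ?_ ?_ ?_
  · intro q hq
    rw [Finset.mem_Icc] at hq ⊢; omega
  · intro q hq
    rw [Finset.mem_Icc] at hq ⊢; omega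
  · intro q hq
    rw [Finset.mem_Icc] at hq; omega
  · intro q hq
    rw [Finset.mem_Icc] at hq; omega
  · intro q hq
    rw [Finset.mem_Icc] at hq
    rw [leftEdge, if_neg (by omega), if_neg (by omega)]

/-- As `Z` misses the vertices of `U`, the parity of `Z` above a vertex is unchanged along
horizontal and vertical edges of `U`. For a chord `i` of `U`, the two ends see the chords `j ≤ i`
and `j ≥ i` of `Z`; chord `i` is not in `Z`, so together these count all chords of `Z`, an odd
number. -/
theorem crossing_ends (h : Params k T o) {Z U : Finset Edge} (hZ : IsEvenSet k Z)
    (hU : IsEvenSet k U) (hd : Disjoint Z U) (hneg : ∑ e ∈ Z, (signedWall k).sign e = 1)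
    {e : Edge} (he : e ∈ U) :
    crossing k T o Z (ends k e).1.1 ((ends k e).1.2 + 1) +
      crossing k T o Z (ends k e).2.1 ((ends k e).2.2 + 1) = (signedWall k).sign e := by
  have h1 := h.eq; have h2 := h.le_one; have h3 := h.two_le
  have heE := hU.isEdge e he
  have key := fun p c => h.ind_eq_zero_of_disjoint hZ hU hd he (p := p) (c := c)
  rcases e with ⟨p, c⟩ | ⟨r, j⟩ | i
  · rw [h.isEdge_horizontal] at heE
    have h4 := (key p (c + 1) heE.1
      (Or.inl ((h.horizontal_eq_leftEdge heE).2 ⟨rfl, rfl⟩).symm)).2.2.1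
    rw [sign_horizontal]
    exact (h.crossing_add_crossing hZ p (c + 1)).trans h4
  · have h4 := (key (r + 1) (col k r j) (by omega) (Or.inr (Or.inr (Or.inr rfl)))).2.1
    rw [sign_vertical]
    change crossing k T o Z r (col k r j + 1) + crossing k T o Z (r + 1) (col k r j + 1) = 0
    rw [crossing_succ, h4, add_zero, SignedGraph.zmod_two_add_self]
  · rw [sign_chord heE]
    rw [h.isEdge_chord] at heE
    obtain ⟨hi, hi'⟩ := heE
    change crossing k T o Z (x k i).1 ((x k i).2 + 1) +
      crossing k T o Z (y k i).1 ((y k i).2 + 1) = 1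
    rw [h.x_eq, h.y_eq' hi]
    have h4 := key i (T - min i (2 * T + 1 - i)) hi
      (Or.inl ((h.chord_eq_leftEdge hi hi' hi).2 (Or.inl ⟨le_rfl, rfl⟩)).symm)
    have h5 := key (2 * T + 1 - i) (3 * T + min i (2 * T + 1 - i) - 2 - 2 * o) (by omega)
      (Or.inr (Or.inl ((h.chord_eq_leftEdge hi hi' (by omega)).2
        (Or.inr ⟨by omega, by omega⟩)).symm))
    have h6 : crossing k T o Z i (T - min i (2 * T + 1 - i) + 1) =
        ∑ j ∈ Finset.Icc 1 i, ind k Z (.chord j) := by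
      rw [← crossing_zero]
      symm
      refine h.crossing_eq hZ (by omega) fun j _ hj => ?_
      by_cases h7 : j = T - min i (2 * T + 1 - i)
      · rw [h7]; exact h4.2.2.1
      · refine h.ind_vertical hZ ?_
        unfold IsVer; omega
    have h8 : crossing k T o Z (2 * T + 1 - i)
        (3 * T + min i (2 * T + 1 - i) - 2 - 2 * o + 1) =
        ∑ j ∈ Finset.Icc i (2 * T), ind k Z (.chord j) := by
      rw [← h.crossing_last hi (by omega)]
      refine h.crossing_eq hZ (by omega) fun j hj _ => ?_
      refine h.ind_vertical hZ ?_
      unfold IsVer; omega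
    have h9 : ind k Z (.chord i) = 0 := by
      have := ind_mul_ind (k := k) hd (.chord i)
      rw [show ind k U (.chord i) = 1 from ind_of_mem he, mul_one] at this
      exact this
    rw [h6, h8]
    have h10 : ∑ j ∈ Finset.Icc 1 i, ind k Z (.chord j) =
        ∑ j ∈ Finset.Ico 1 i, ind k Z (.chord j) := by
      rw [← Finset.Ico_insert_right hi, Finset.sum_insert (by simp), h9, zero_add]
    have h11 : Finset.Icc i (2 * T) = Finset.Ico i (2 * T + 1) := by
      ext; simp only [Finset.mem_Icc, Finset.mem_Ico]; omega
    have h12 : Finset.Icc 1 (2 * T) = Finset.Ico 1 (2 * T + 1) := by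
      ext; simp only [Finset.mem_Icc, Finset.mem_Ico]; omega
    rw [h10, h11, Finset.sum_Ico_consecutive _ hi (by omega), ← h12, h.sum_sign hZ, hneg]

/-- Two even sets with an odd number of chords each have an edge in common. -/
theorem not_disjoint (h : Params k T o) {Z U : Finset Edge} (hZ : IsEvenSet k Z)
    (hU : IsEvenSet k U) (hZneg : ∑ e ∈ Z, (signedWall k).sign e = 1)
    (hUneg : ∑ e ∈ U, (signedWall k).sign e = 1) : ¬ Disjoint Z U := by
  classical
  intro hd
  set ψ : ℕ × ℕ → ZMod 2 := fun a => crossing k T o Z a.1 (a.2 + 1) with hψ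
  set W : Finset (ℕ × ℕ) := U.image (fun e => (ends k e).1) ∪ U.image (fun e => (ends k e).2)
    with hW
  have h1 : ∀ a ∈ W, ∑ z ∈ W, ψ z * SignedGraph.vind a z = ψ a := by
    intro a ha
    rw [Finset.sum_eq_single a]
    · simp [SignedGraph.vind]
    · intro b _ hb
      rw [SignedGraph.vind, if_neg (Ne.symm hb), mul_zero]
    · exact fun h => (h ha).elim
  have h2 : ∀ e ∈ U, (signedWall k).sign e = ∑ z ∈ W, ψ z * boundary k e z := by
    intro e he
    rw [← h.crossing_ends hZ hU hd hZneg he]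
    simp only [boundary, mul_add, Finset.sum_add_distrib]
    rw [h1 _ (Finset.mem_union_left _ (Finset.mem_image_of_mem _ he)),
      h1 _ (Finset.mem_union_right _ (Finset.mem_image_of_mem (fun e => (ends k e).2) he))]
  -- Summation by parts: the signs of `U` add up to `ψ` paired with the boundary of `U`, which
  -- vanishes.
  rw [Finset.sum_congr rfl h2, Finset.sum_comm] at hUneg
  simp only [← Finset.mul_sum, hU.even, mul_zero, Finset.sum_const_zero] at hUneg
  exact zero_ne_one hUneg

end Params

end Wall

/-! ### Degrees and divalent vertices of the wall -/

namespace Wall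

variable {k T o : ℕ}

/-- The grid point is a vertex of the wall. -/
def IsVertex (T o p c : ℕ) : Prop :=
  1 ≤ p ∧ p ≤ 2 * T ∧ T - min p (2 * T + 1 - p) ≤ c ∧
    c ≤ 3 * T + min p (2 * T + 1 - p) - 2 - 2 * o

/-- The vertex is one of the two ends of paths without a chord. -/
def IsFreeEnd (T o p c : ℕ) : Prop :=
  o = 1 ∧ ((p = 2 * T ∧ c + 1 = T) ∨ (p = 1 ∧ c + 3 = 3 * T))

/-- The vertex is divalent. -/
def IsDivalent (T o p c : ℕ) : Prop :=
  IsVertex T o p c ∧ (IsFreeEnd T o p c ∨ (¬ IsVer T o p c ∧ ¬ IsVer T o (p - 1) c))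

/-- The edge to the preceding vertex in an orientation of the wall. -/
def upEdge (T o : ℕ) (d : ℕ × ℕ) : Edge :=
  -- The forest edges go left, except at the first vertex of path `2T` for odd `k`: it has neither a
  -- left neighbour nor a chord.
  if o = 1 ∧ d.1 = 2 * T ∧ d.2 + 1 = T then .vertical (2 * T - 1) 0 else .horizontal d.1 (d.2 - 1)

/-- The preceding vertex in an orientation of the wall. -/
def upVertex (T o : ℕ) (d : ℕ × ℕ) : ℕ × ℕ :=
  if o = 1 ∧ d.1 = 2 * T ∧ d.2 + 1 = T then (2 * T - 1, d.2) else (d.1, d.2 - 1)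

theorem isLink_loopless {e : Edge} {a : ℕ × ℕ} (hT : Params k T o) :
    ¬ (signedWall k).graph.IsLink e a a := by
  have h1 := hT.eq; have h2 := hT.le_one; have h3 := hT.two_le
  rintro ⟨he, h⟩
  rw [or_self] at h
  rcases e with ⟨p, c⟩ | ⟨r, j⟩ | i
  · simp only [ends, Prod.ext_iff] at h; omega
  · simp only [ends, Prod.ext_iff] at h; omega
  · rw [hT.isEdge_chord] at he
    simp only [ends, hT.x_eq, hT.y_eq' he.1, Prod.ext_iff] at h
    omega

namespace Params

theorem mem_vertices (h : Params k T o) (p c : ℕ) : (p, c) ∈ vertices k ↔ IsVertex T o p c := by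
  have h1 := h.eq; have h2 := h.le_one; have h3 := h.two_le
  simp only [vertices, mem_ofPred_eq, mem_Icc, numPaths, h.mid_eq, endCol, h.startCol_eq,
    h.rowLength_eq, pathIndex, IsVertex]
  omega

theorem inc_iff (h : Params k T o) {p c : ℕ} (hz : IsVertex T o p c) (e : Edge) :
    (signedWall k).graph.Inc e (p, c) ↔ IsEdge k e ∧ (toCol k e = leftEdge T o p c ∨
      toCol k e = leftEdge T o p (c + 1) ∨ toCol k e = .vertical p c ∨
      toCol k e = .vertical (p - 1) c) := by
  have h1 := h.eq; have h2 := h.le_one; have h3 := h.two_le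
  unfold IsVertex at hz
  have h4 : (signedWall k).graph.Inc e (p, c) ↔
      IsEdge k e ∧ ((ends k e).1 = (p, c) ∨ (ends k e).2 = (p, c)) := by
    constructor
    · rintro ⟨b, he, h | h⟩
      · exact ⟨he, Or.inl (by rw [h])⟩
      · exact ⟨he, Or.inr (by rw [h])⟩
    · rintro ⟨he, h | h⟩
      · exact ⟨(ends k e).2, he, Or.inl (by rw [← h])⟩
      · exact ⟨(ends k e).1, he, Or.inr (by rw [← h])⟩
  rw [h4]
  refine and_congr_right fun he => ?_
  rcases e with ⟨p', c'⟩ | ⟨r, j⟩ | i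
  · rw [h.isEdge_horizontal] at he
    simp only [ends, toCol, h.horizontal_eq_leftEdge he, Prod.mk.injEq, reduceCtorEq, or_false]
    omega
  · simp only [ends, toCol, Prod.mk.injEq, vertical_ne_leftEdge, Edge.vertical.injEq, col, false_or]
    omega
  · rw [h.isEdge_chord] at he
    simp only [ends, toCol, h.x_eq, h.y_eq' he.1, Prod.mk.injEq, reduceCtorEq,
      h.chord_eq_leftEdge he.1 he.2 hz.1, or_false]
    omega

theorem lt_of_isDivalent (h : Params k T o) {p c : ℕ} (hd : IsDivalent T o p c)
    (hf : ¬ IsFreeEnd T o p c) : 1 ≤ p ∧ p ≤ 2 * T ∧ T - min p (2 * T + 1 - p) < c ∧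
      c < 3 * T + min p (2 * T + 1 - p) - 2 - 2 * o ∧ ¬ IsVer T o p c ∧
      ¬ IsVer T o (p - 1) c := by
  have h1 := h.eq; have h2 := h.le_one; have h3 := h.two_le
  obtain ⟨hv, h4⟩ := hd
  have h5 := h4.resolve_left hf
  unfold IsVertex at hv
  refine ⟨hv.1, hv.2.1, ?_, ?_, h5⟩
  · by_contra h6
    rcases le_or_gt p T with h7 | h7
    · exact h5.1 (by unfold IsFreeEnd at hf; unfold IsVer; omega)
    · exact h5.2 (by unfold IsFreeEnd at hf; unfold IsVer; omega)
  · by_contra h6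
    rcases le_or_gt p T with h7 | h7
    · exact h5.1 (by unfold IsFreeEnd at hf; unfold IsVer; omega)
    · exact h5.2 (by unfold IsFreeEnd at hf; unfold IsVer; omega)

theorem upEdge_of_freeEnd (h : Params k T 1) :
    IsEdge k (upEdge T 1 (2 * T, T - 1)) ∧
      toCol k (upEdge T 1 (2 * T, T - 1)) = .vertical (2 * T - 1) (T - 1) := by
  have h3 := h.two_le
  rw [upEdge, if_pos (by simp only [true_and]; omega), h.isEdge_vertical, toCol,
    show col k (2 * T - 1) 0 = T - 1 by rw [h.col_eq]; omega]
  refine ⟨?_, rfl⟩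
  unfold IsVer; omega

theorem upEdge_of_not (h : Params k T o) {p c : ℕ} (hd : IsDivalent T o p c)
    (hf : ¬ (o = 1 ∧ p = 2 * T ∧ c + 1 = T)) : upEdge T o (p, c) = .horizontal p (c - 1) ∧
      IsHor T o p (c - 1) := by
  have h1 := h.eq; have h2 := h.le_one; have h3 := h.two_le
  refine ⟨if_neg hf, ?_⟩
  by_cases h4 : IsFreeEnd T o p c
  · unfold IsFreeEnd at h4; unfold IsHor; omega
  · have := h.lt_of_isDivalent hd h4
    unfold IsHor; omega

theorem isEdge_upEdge (h : Params k T o) {p c : ℕ} (hd : IsDivalent T o p c) :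
    IsEdge k (upEdge T o (p, c)) := by
  by_cases hf : o = 1 ∧ p = 2 * T ∧ c + 1 = T
  · obtain ⟨rfl, rfl, rfl⟩ := hf
    exact h.upEdge_of_freeEnd.1
  · obtain ⟨h1, h2⟩ := h.upEdge_of_not hd hf
    rw [h1, h.isEdge_horizontal]
    exact h2

/-- A divalent vertex has exactly one incident edge besides the edge to the preceding vertex. -/
theorem exists_other_edge (h : Params k T o) {p c : ℕ} (hd : IsDivalent T o p c) :
    ∃ e, IsEdge k e ∧ e ≠ upEdge T o (p, c) ∧
      (∀ f, (signedWall k).graph.Inc f (p, c) ↔ f = upEdge T o (p, c) ∨ f = e) ∧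
      (e = .horizontal p c ∨ toCol k e = .vertical p c ∧ p = 1 ∧ o = 1 ∧ c + 3 = 3 * T) := by
  have h1 := h.eq; have h2 := h.le_one; have h3 := h.two_le
  have hup := h.isEdge_upEdge hd
  have key : ∀ e, IsEdge k e → toCol k e ≠ toCol k (upEdge T o (p, c)) →
      (∀ E, IsColEdge T o E → ((E = leftEdge T o p c ∨ E = leftEdge T o p (c + 1) ∨
        E = .vertical p c ∨ E = .vertical (p - 1) c) ↔
        E = toCol k (upEdge T o (p, c)) ∨ E = toCol k e)) →
      (e = .horizontal p c ∨ toCol k e = .vertical p c ∧ p = 1 ∧ o = 1 ∧ c + 3 = 3 * T) →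
      ∃ e, IsEdge k e ∧ e ≠ upEdge T o (p, c) ∧
      (∀ f, (signedWall k).graph.Inc f (p, c) ↔ f = upEdge T o (p, c) ∨ f = e) ∧
      (e = .horizontal p c ∨ toCol k e = .vertical p c ∧ p = 1 ∧ o = 1 ∧ c + 3 = 3 * T) := by
    intro e he hne hE hlast
    refine ⟨e, he, fun h' => hne (h' ▸ rfl), fun f => ?_, hlast⟩
    rw [h.inc_iff hd.1]
    constructor
    · rintro ⟨hf, hf'⟩
      rcases (hE _ (h.isColEdge_toCol hf)).1 hf' with h5 | h5
      · exact Or.inl (toCol_injective h5)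
      · exact Or.inr (toCol_injective h5)
    · rintro (rfl | rfl)
      · exact ⟨hup, (hE _ (h.isColEdge_toCol hup)).2 (Or.inl rfl)⟩
      · exact ⟨he, (hE _ (h.isColEdge_toCol he)).2 (Or.inr rfl)⟩
  by_cases hx : o = 1 ∧ p = 2 * T ∧ c + 1 = T
  · obtain ⟨rfl, rfl, hc⟩ := hx
    obtain rfl : c = T - 1 := by omega
    have hh : IsHor T 1 (2 * T) (T - 1) := by unfold IsHor; omega
    rw [h.upEdge_of_freeEnd.2] at key
    refine key (.horizontal (2 * T) (T - 1)) ((h.isEdge_horizontal _ _).2 hh) (by simp [toCol])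
      ?_ (Or.inl rfl)
    intro E hE
    rcases E with ⟨p', c'⟩ | ⟨r, j⟩ | i <;> simp only [IsColEdge] at hE
    · simp only [h.horizontal_eq_leftEdge hE, toCol, Edge.horizontal.injEq, reduceCtorEq,
        or_false, false_or]
      unfold IsHor at hE
      omega
    · simp only [vertical_ne_leftEdge, toCol, Edge.vertical.injEq, reduceCtorEq, or_false,
        false_or]
      unfold IsVer at hE
      omega
    · simp only [h.chord_eq_leftEdge hE.1 hE.2 hd.1.1, toCol, reduceCtorEq, or_false, iff_false]
      omega
  obtain ⟨hup1, hup2⟩ := h.upEdge_of_not hd hx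
  rw [hup1] at key ⊢
  by_cases hy : o = 1 ∧ p = 1 ∧ c + 3 = 3 * T
  · obtain ⟨rfl, rfl, hc⟩ := hy
    obtain rfl : c = 3 * T - 3 := by omega
    obtain ⟨j, hj, hjc⟩ := h.exists_vertical (r := 1) (c := 3 * T - 3) (by unfold IsVer; omega)
    have htc : toCol k (.vertical 1 j) = .vertical 1 (3 * T - 3) := by rw [toCol, hjc]
    refine key (.vertical 1 j) hj ?_ ?_ (Or.inr ⟨htc, rfl, rfl, by omega⟩)
    · rw [htc]; simp [toCol]
    · intro E hE
      rw [htc]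
      rcases E with ⟨p', c'⟩ | ⟨r, j⟩ | i <;> simp only [IsColEdge] at hE
      · simp only [h.horizontal_eq_leftEdge hE, toCol, Edge.horizontal.injEq, reduceCtorEq,
          or_false]
        unfold IsHor at hE
        omega
      · simp only [vertical_ne_leftEdge, toCol, Edge.vertical.injEq, reduceCtorEq, false_or]
        unfold IsVer at hE
        omega
      · simp only [h.chord_eq_leftEdge hE.1 hE.2 hd.1.1, toCol, reduceCtorEq, or_false, iff_false]
        omega
  · have hf : ¬ IsFreeEnd T o p c := by unfold IsFreeEnd; omega
    obtain ⟨h5, h6, h7, h8, h9, h10⟩ := h.lt_of_isDivalent hd hf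
    have hh : IsHor T o p c := by unfold IsHor; omega
    refine key _ ((h.isEdge_horizontal _ _).2 hh) ?_ ?_ (Or.inl rfl)
    · simp only [toCol, ne_eq, Edge.horizontal.injEq]
      omega
    · intro E hE
      simp only [toCol]
      rcases E with ⟨p', c'⟩ | ⟨r, j⟩ | i <;> simp only [IsColEdge] at hE
      · simp only [h.horizontal_eq_leftEdge hE, Edge.horizontal.injEq, reduceCtorEq, or_false]
        omega
      · simp only [vertical_ne_leftEdge, Edge.vertical.injEq, reduceCtorEq, or_false, false_or,
          iff_false, not_or, not_and]
        constructor
        · rintro rfl rfl; exact h9 hE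
        · rintro rfl rfl; exact h10 hE
      · simp only [h.chord_eq_leftEdge hE.1 hE.2 hd.1.1, reduceCtorEq, or_false, iff_false]
        omega

/-- The vertices that are not divalent have three incident edges. -/
theorem encard_incidenceSet (h : Params k T o) {p c : ℕ} (hv : IsVertex T o p c)
    (hd : ¬ IsDivalent T o p c) :
    ((signedWall k).graph.incidenceSet (p, c)).encard = 3 := by
  have h1 := h.eq; have h2 := h.le_one; have h3 := h.two_le
  have hv' := id hv
  unfold IsVertex at hv'
  have hd' : ¬ IsFreeEnd T o p c ∧ (IsVer T o p c ∨ IsVer T o (p - 1) c) := by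
    unfold IsDivalent at hd; tauto
  obtain ⟨hf, hver⟩ := hd'
  unfold IsFreeEnd at hf
  obtain ⟨r, hr, hrp⟩ : ∃ r, IsVer T o r c ∧ (r = p ∨ r = p - 1) := by
    rcases hver with hver | hver
    · exact ⟨p, hver, Or.inl rfl⟩
    · exact ⟨p - 1, hver, Or.inr rfl⟩
  have himg : toCol k '' (signedWall k).graph.incidenceSet (p, c) =
      {leftEdge T o p c, leftEdge T o p (c + 1), .vertical r c} := by
    have hsurj : ∀ E, IsColEdge T o E → ∃ e, IsEdge k e ∧ toCol k e = E := by
      intro E hE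
      rcases E with ⟨p', c'⟩ | ⟨r, c'⟩ | i
      · exact ⟨_, (h.isEdge_horizontal p' c').2 hE, rfl⟩
      · obtain ⟨j, hj, hjc⟩ := h.exists_vertical hE
        exact ⟨_, hj, by rw [toCol, hjc]⟩
      · exact ⟨_, (h.isEdge_chord i).2 hE, rfl⟩
    have hl : IsColEdge T o (leftEdge T o p c) := by
      unfold leftEdge
      split_ifs <;> simp only [IsColEdge, IsHor] <;> omega
    have hl' : IsColEdge T o (leftEdge T o p (c + 1)) := by
      unfold leftEdge
      split_ifs <;> simp only [IsColEdge, IsHor] <;> omega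
    ext E
    constructor
    · rintro ⟨e, he, rfl⟩
      obtain ⟨he, h4⟩ := (h.inc_iff hv e).1 he
      have h5 := h.isColEdge_toCol he
      rcases h4 with h4 | h4 | h4 | h4
      · exact Or.inl h4
      · exact Or.inr (Or.inl h4)
      · rw [h4] at h5
        have h6 : r = p := by
          simp only [IsColEdge] at h5; unfold IsVer at hr h5; omega
        rw [h4, h6]; exact Or.inr (Or.inr rfl)
      · rw [h4] at h5
        have h6 : r = p - 1 := by
          simp only [IsColEdge] at h5; unfold IsVer at hr h5; omega
        rw [h4, h6]; exact Or.inr (Or.inr rfl)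
    · intro hE
      have hE' : IsColEdge T o E := by
        rcases hE with rfl | rfl | rfl
        · exact hl
        · exact hl'
        · exact hr
      obtain ⟨e, he, rfl⟩ := hsurj E hE'
      refine ⟨e, (h.inc_iff hv e).2 ⟨he, ?_⟩, rfl⟩
      rcases hE with hE | hE | hE
      · exact Or.inl hE
      · exact Or.inr (Or.inl hE)
      · rcases hrp with rfl | rfl
        · exact Or.inr (Or.inr (Or.inl hE))
        · exact Or.inr (Or.inr (Or.inr hE))
  have hne : leftEdge T o p c ≠ leftEdge T o p (c + 1) := by
    unfold leftEdge
    split_ifs <;> simp only [ne_eq, Edge.horizontal.injEq, Edge.chord.injEq, reduceCtorEq,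
      not_false_eq_true] <;> omega
  rw [← (toCol_injective (k := k)).encard_image, himg, encard_insert_of_notMem, encard_pair]
  · norm_num
  · exact vertical_ne_leftEdge.symm
  · rintro (h4 | h4)
    · exact hne h4
    · exact vertical_ne_leftEdge h4.symm

theorem degree_eq (h : Params k T o) (a : ℕ × ℕ) :
    (wallWithChords k).degree a = ((wallWithChords k).incidenceSet a).encard := by
  have : (wallWithChords k).loopSet a = ∅ := by
    rw [eq_empty_iff_forall_notMem]
    exact fun e he => isLink_loopless (e := e) (a := a) h he
  rw [Graph.degree, this, encard_empty, add_zero]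

theorem degree_eq_two_iff (h : Params k T o) {p c : ℕ} (hv : IsVertex T o p c) :
    (wallWithChords k).degree (p, c) = 2 ↔ IsDivalent T o p c := by
  rw [h.degree_eq]
  constructor
  · intro h1
    by_contra h2
    have h3 := h.encard_incidenceSet hv h2
    have h4 : (3 : ℕ∞) = 2 := h3.symm.trans h1
    exact absurd h4 (by decide)
  · intro hd
    obtain ⟨e, he, hne, hinc, -⟩ := h.exists_other_edge hd
    have h1 : (wallWithChords k).incidenceSet (p, c) = {upEdge T o (p, c), e} := by
      ext f; exact hinc f
    rw [h1, encard_pair hne.symm]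

/-- Any set of divalent vertices of the wall can be suppressed. -/
theorem isSuppressible (h : Params k T o) {D : Set (ℕ × ℕ)}
    (hD : ∀ p c, (p, c) ∈ D → IsDivalent T o p c) :
    (signedWall k).IsSuppressible D (upVertex T o) (upEdge T o) fun a => a.1 + a.2 where
  link := by
    rintro ⟨p, c⟩ hd
    have h1 := h.isEdge_upEdge (hD p c hd)
    refine ⟨h1, Or.inr ?_⟩
    have h3 := h.two_le
    by_cases hx : o = 1 ∧ p = 2 * T ∧ c + 1 = T
    · have h5 : col k (2 * T - 1) 0 = c := by rw [h.col_eq]; omega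
      rw [upEdge, if_pos hx, upVertex, if_pos hx]
      change ((2 * T - 1, col k (2 * T - 1) 0), (2 * T - 1 + 1, col k (2 * T - 1) 0)) = _
      rw [h5, hx.2.1]
      congr 2; omega
    · have h5 := (h.upEdge_of_not (hD p c hd) hx).2
      rw [upEdge, if_neg hx, upVertex, if_neg hx]
      unfold IsHor at h5
      have h6 := (hD p c hd)
      have h7 : c - 1 + 1 = c := by
        by_cases h8 : IsFreeEnd T o p c
        · unfold IsFreeEnd at h8; omega
        · have := h.lt_of_isDivalent h6 h8; omega
      simp only [ends, h7]
  rank_parent := by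
    rintro ⟨p, c⟩ hd
    have h1 := h.eq; have h2 := h.le_one; have h3 := h.two_le
    simp only [upVertex]
    have h6 := (hD p c hd)
    split_ifs with hx
    · simp only; omega
    · have h7 : c - 1 + 1 = c := by
        by_cases h8 : IsFreeEnd T o p c
        · unfold IsFreeEnd at h8; omega
        · have := h.lt_of_isDivalent h6 h8; omega
      simp only; omega
  rank_bound := by
    refine ⟨10 * T, ?_⟩
    rintro ⟨p, c⟩ hd
    have h6 := (hD p c hd).1
    unfold IsVertex at h6
    simp only; omega
  inc := by
    rintro ⟨p, c⟩ hd
    obtain ⟨e, he, hne, hinc, -⟩ := h.exists_other_edge (hD p c hd)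
    exact ⟨e, hne, (hinc e).2 (Or.inr rfl), fun f hf => (hinc f).1 hf⟩
  up_notMem := by
    rintro d hd ⟨i, -, hi⟩
    unfold upEdge at hi
    split_ifs at hi
  other := by
    rintro e ⟨p, c⟩ b hl he hd
    have h1 := h.eq; have h2 := h.le_one; have h3 := h.two_le
    have hdiv := hD p c hd
    obtain ⟨e', he', hne, hinc, h4⟩ := h.exists_other_edge hdiv
    have h5 : e = e' := ((hinc e).1 hl.inc_left).resolve_left fun h6 => he ⟨_, hd, h6.symm⟩
    subst h5
    rcases h4 with rfl | ⟨h4, rfl, rfl, hc⟩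
    · have hb : b = (p, c + 1) := by
        rcases hl.2 with h6 | h6 <;> simp only [ends, Prod.ext_iff] at h6 ⊢ <;> omega
      subst hb
      -- If the right neighbour were in `D`, this edge would be its forest edge; the exceptional
      -- vertex starts its path and is nobody's right neighbour.
      refine ⟨fun hb => he ⟨_, hb, ?_⟩, by simp⟩
      refine if_neg ?_
      unfold IsDivalent IsVertex at hdiv
      simp only
      omega
    · rcases e with ⟨p', c'⟩ | ⟨r, j⟩ | i <;>
    simp only [toCol, Edge.vertical.injEq, reduceCtorEq] at h4
      obtain ⟨rfl, h4⟩ := h4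
      have hb : b = (2, c) := by
        have h7 : ends k (.vertical 1 j) = ((1, c), (2, c)) := by rw [← h4]; rfl
        rcases hl.2 with h6 | h6 <;> rw [h7] at h6 <;>
          simp only [Prod.ext_iff] at h6 ⊢ <;> omega
      subst hb
      refine ⟨fun hb => ?_, by simp⟩
      have h6 := hD 2 c hb
      -- The vertex below the chordless end of path 1 has this vertical edge, hence is not divalent.
      refine (h.lt_of_isDivalent h6 (by unfold IsFreeEnd; omega)).2.2.2.2.2 ?_
      unfold IsVer; omega
  loopless := fun e a => isLink_loopless h

/-- Suppressing divalent vertices of the wall yields a signed graph in `SStar k`. -/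
theorem suppress_mem_sStar (h : Params k T o) {D : Set (ℕ × ℕ)}
    (hD : ∀ p c, (p, c) ∈ D → IsDivalent T o p c) :
    (signedWall k).suppress D ∈ SignedGraph.SStar k := by
  have h1 := h.eq; have h2 := h.le_one; have h3 := h.two_le
  refine (h.isSuppressible hD).suppress_mem_sStar (by omega) isBoundary_boundary h.le_encard_bad
    ?_ ?_ ?_
  · obtain ⟨s, -, hs⟩ := h.exists_mem_bad_encard_le (e := .chord 1)
      ((h.isEdge_chord 1).2 (by omega))
    exact ⟨s, hs⟩
  · intro e he
    rw [edgeSet_eq] at he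
    exact h.exists_mem_bad_encard_le he
  · intro Z U hZ hU hZ' hU' hZneg hUneg
    rw [edgeSet_eq] at hZ hU
    exact h.not_disjoint ⟨fun e he => hZ he, hZ'⟩ ⟨fun e he => hU he, hU'⟩ hZneg hUneg

end Params

end Wall

/-! ### The theorem: two choices of the suppressed set -/

theorem mainTheorem5 (k : ℕ) (hk : 3 ≤ k) :
    Wall.escherWall k ∈ SignedGraph.SStar k ∧
    (Wall.cubicEscherWall k).graph.IsCubic ∧
    Wall.cubicEscherWall k ∈ SignedGraph.SStar k := by
  obtain ⟨T, o, h⟩ := Wall.exists_params hk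
  have hD : ∀ p c, (p, c) ∈ {a | a ∈ Wall.vertices k ∧ (Wall.wallWithChords k).degree a = 2} →
      Wall.IsDivalent T o p c := by
    rintro p c ⟨h1, h2⟩
    exact (h.degree_eq_two_iff ((h.mem_vertices p c).1 h1)).1 h2
  refine ⟨h.suppress_mem_sStar ?_, ?_, h.suppress_mem_sStar hD⟩
  · rintro p c ⟨hodd, hpc⟩
    have h1 := h.eq; have h2 := h.le_one; have h3 := h.two_le
    rw [Nat.odd_iff] at hodd
    rw [h.x_eq, h.y_eq' (by omega), Prod.mk.injEq, Prod.mk.injEq] at hpc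
    unfold Wall.IsDivalent Wall.IsVertex Wall.IsFreeEnd
    omega
  · rintro ⟨p, c⟩ ⟨hv, hpc⟩
    have h1 := (h.mem_vertices p c).1 hv
    have h2 : ¬ Wall.IsDivalent T o p c := fun h3 => hpc ⟨hv, (h.degree_eq_two_iff h1).2 h3⟩
    exact ((h.isSuppressible hD).degree_suppress hpc).trans (h.encard_incidenceSet h1 h2)
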